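/- Work in ZFC, and let HOD be the class of hereditarily ordinal definable sets. For an uncountable regular cardinal $\lambda$ write $\mathrm{cof}(\omega)\cap\lambda$ for the set of ordinals $\alpha<\lambda$ whose cofinality (in $V$) is $\omega$; clubs in $\lambda$ and stationary subsets of $\lambda$ are also meant in $V$. The cardinal $\lambda$ is called $\omega$-strongly measurable in HOD if there is a nonzero ordinal $\kappa<\lambda$ such that (1) $(2^\kappa)^{\mathrm{HOD}}<\lambda$, where $(2^\kappa)^{\mathrm{HOD}}$ is the cardinality, computed in HOD, of the power set of $\kappa$ in HOD, and (2) there is no partition $\langle S_\alpha\mid\alpha<\kappa\rangle$ of $\mathrm{cof}(\omega)\cap\lambda$ into sets stationary in $\lambda$ with $\langle S_\alpha\mid\alpha<\kappa\rangle\in\mathrm{HOD}$. **Lemma.** Let $\lambda$ be an uncountable regular cardinal that is $\omega$-strongly measurable in HOD. Then $$\mathrm{HOD}\models\text{``}\lambda\text{ is a measurable cardinal''},$$ that is, HOD satisfies that $\lambda$ is an uncountable cardinal carrying a nonprincipal $\lambda$-complete ultrafilter on $\lambda$. Moreover, there is a set $S\subseteq\mathrm{cof}(\omega)\cap\lambda$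 with $S\in\mathrm{HOD}$, stationary in $\lambda$ (in $V$), such that, for $$\mathcal F=\{X\subseteq S\mid \text{there is a club } C\subseteq\lambda \text{ with } C\cap S\subseteq X\},\qquad \mathcal G=\mathcal F\cap\mathrm{HOD},$$ we have $\mathcal G\in\mathrm{HOD}$ and $$\mathrm{HOD}\models\text{``}\mathcal G\text{ is a nonprincipal }\lambda\text{-complete ultrafilter on } S\text{''}.$$ -/

import Mathlib

universe u

open Cardinal

/-! ### Set-theoretic notions evaluated in an arbitrary structure `(M, E)`

`E x y` is read as "`x ∈ y`". Every quantifier below ranges over `M`, so that for a formula `φ`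
of set theory the predicate named after it says `(M, E) ⊨ φ`. -/

namespace SetModel

section

variable {M : Type*} (E : M → M → Prop)

/-- `(M, E) ⊨ x ⊆ y`. -/
def Sub (x y : M) : Prop := ∀ z, E z x → E z y

/-- `(M, E) ⊨ p = {x, y}`. -/
def IsUPair (p x y : M) : Prop := ∀ z, E z p ↔ z = x ∨ z = y

/-- `(M, E) ⊨ p = (x, y)`, the Kuratowski pair `{{x}, {x, y}}`. -/
def IsOPair (p x y : M) : Prop :=
  ∃ a b, IsUPair E a x x ∧ IsUPair E b x y ∧ IsUPair E p a b

/-- `(M, E) ⊨ (x, y) ∈ f`. -/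
def Maps (f x y : M) : Prop := ∃ p, IsOPair E p x y ∧ E p f

/-- `(M, E) ⊨ f` is a function with domain `d`. -/
def IsFunOn (f d : M) : Prop :=
  (∀ p, E p f → ∃ x y, E x d ∧ IsOPair E p x y) ∧ ∀ x, E x d → ∃! y, Maps E f x y

/-- `(M, E) ⊨ f : d → c` is a bijection. -/
def IsBijection (f d c : M) : Prop :=
  IsFunOn E f d ∧ (∀ x y, Maps E f x y → E y c) ∧ ∀ y, E y c → ∃! x, Maps E f x y

/-- `(M, E) ⊨ x` is a transitive set. -/
def IsTrans (x : M) : Prop := ∀ y, E y x → Sub E y x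

/-- `(M, E) ⊨ x` is an ordinal (a transitive set of transitive sets). -/
def IsOrd (x : M) : Prop := IsTrans E x ∧ ∀ y, E y x → IsTrans E y

/-- `(M, E) ⊨ x` is a nonzero limit ordinal. -/
def IsLimitOrd (x : M) : Prop :=
  IsOrd E x ∧ (∃ y, E y x) ∧ ∀ y, E y x → ∃ z, E z x ∧ E y z

/-- `(M, E) ⊨ x = ω`, the least nonzero limit ordinal. -/
def IsOmega (x : M) : Prop := IsLimitOrd E x ∧ ∀ y, E y x → ¬ IsLimitOrd E y

/-- `(M, E) ⊨ x` is a cardinal (an ordinal not equinumerous with any smaller ordinal). -/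
def IsCard (x : M) : Prop := IsOrd E x ∧ ∀ y, E y x → ¬ ∃ f, IsBijection E f y x

/-- `(M, E) ⊨ p = 𝒫(x)`. -/
def IsPowerset (p x : M) : Prop := ∀ z, E z p ↔ Sub E z x

/-- `(M, E) ⊨ m = 2 ^ k`, in the sense of cardinal exponentiation:
`m` is the cardinality of the power set of `k`. -/
def IsTwoPow (m k : M) : Prop :=
  IsCard E m ∧ ∃ p, IsPowerset E p k ∧ ∃ f, IsBijection E f m p

/-- `(M, E) ⊨ U` is an ultrafilter on the set `s`. -/
structure IsUltrafilterOn (U s : M) : Prop where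
  sub : ∀ X, E X U → Sub E X s
  top_mem : E s U
  nonempty : ∀ X, E X U → ∃ z, E z X
  upward : ∀ X Y, E X U → Sub E X Y → Sub E Y s → E Y U
  inter : ∀ X Y, E X U → E Y U → ∃ Z, E Z U ∧ ∀ z, E z Z ↔ E z X ∧ E z Y
  ultra : ∀ X, Sub E X s → E X U ∨ ∃ Y, E Y U ∧ ∀ z, E z Y ↔ E z s ∧ ¬ E z X

/-- `(M, E) ⊨ U` is `l`-complete: the intersection (inside `s`) of any sequence of members of `U`
of length an ordinal `g < l` is a member of `U`. -/
def IsCompleteOn (l U s : M) : Prop :=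
  ∀ g f, E g l → IsFunOn E f g → (∀ a X, Maps E f a X → E X U) →
    ∃ Y, E Y U ∧ ∀ z, E z Y ↔ E z s ∧ ∀ a X, Maps E f a X → E z X

/-- `(M, E) ⊨ U` contains no singleton (for an ultrafilter: `U` is nonprincipal). -/
def IsNonprincipal (U : M) : Prop := ∀ X, E X U → ¬ ∃ a, IsUPair E X a a

/-- `(M, E) ⊨ l` is a measurable cardinal: an uncountable cardinal carrying a nonprincipal
`l`-complete ultrafilter on `l`. -/
def IsMeasurableCardinal (l : M) : Prop :=
  IsCard E l ∧ (∃ w, IsOmega E w ∧ E w l) ∧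
    ∃ U, IsUltrafilterOn E U l ∧ IsCompleteOn E l U l ∧ IsNonprincipal E U

end

end SetModel

/-! ### Hereditarily ordinal definable sets -/

/-- The only symbol of the language of set theory, a binary relation symbol. -/
inductive MemSymbol : ℕ → Type
  | mem : MemSymbol 2

/-- The first-order language of set theory. -/
def setLang : FirstOrder.Language.{0, 0} := ⟨fun _ => Empty, MemSymbol⟩

/-- A set of `ZFSet`s as a structure for the language of set theory, with the true membership
relation. -/
instance setLangStructure (A : Set ZFSet.{u}) : setLang.Structure A where
  funMap := fun f => f.elim
  RelMap := fun r => match r with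
    | MemSymbol.mem => fun v => (v 0 : ZFSet.{u}) ∈ (v 1 : ZFSet.{u})

/-- The elements of the level `V_a` of the cumulative hierarchy. -/
def levelSet (a : Ordinal.{u}) : Set ZFSet.{u} := {x | x ∈ ZFSet.vonNeumann a}

/-- `x` is ordinal definable: for some ordinal `a` with `x ∈ V_a`, the set `x` is definable over
`(V_a, ∈)` by a first-order formula with ordinal parameters from `V_a`. -/
def IsOD (x : ZFSet.{u}) : Prop :=
  ∃ (a : Ordinal.{u}) (hx : x ∈ levelSet a),
    Set.Definable₁ {p : levelSet a | (p : ZFSet.{u}).IsOrdinal} setLang {⟨x, hx⟩}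

/-- The class of hereditarily ordinal definable sets. -/
def HOD : Set ZFSet.{u} := {x | ZFSet.Hereditarily IsOD x}

/-- The membership relation of the structure `(HOD, ∈)`. -/
def HOD.mem (x y : HOD.{u}) : Prop := (x : ZFSet.{u}) ∈ (y : ZFSet.{u})

theorem isOD_toZFSet (o : Ordinal.{u}) : IsOD o.toZFSet := by
  have hx : o.toZFSet ∈ levelSet (o + 1) := by
    simp only [levelSet, Set.mem_ofPred_eq, ZFSet.mem_vonNeumann, Ordinal.rank_toZFSet]
    exact lt_add_one o
  exact ⟨o + 1, hx, Set.Definable.singleton_of_mem _ (ZFSet.isOrdinal_toZFSet o)⟩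

theorem toZFSet_mem_HOD (o : Ordinal.{u}) : o.toZFSet ∈ HOD := by
  induction o using WellFoundedLT.induction with
  | ind o ih =>
    refine ZFSet.hereditarily_iff.2 ⟨isOD_toZFSet o, fun y hy => ?_⟩
    obtain ⟨a, ha, rfl⟩ := Ordinal.mem_toZFSet_iff.1 hy
    exact ih a ha

/-- The von Neumann ordinal `o` as an element of HOD. -/
noncomputable def HOD.ord (o : Ordinal.{u}) : HOD.{u} := ⟨o.toZFSet, toZFSet_mem_HOD o⟩

/-! ### Clubs and stationary sets in V -/

/-- The set `{a < l | a ∈ S}` of ordinals coded by a `ZFSet`, as a subset of the well-order of the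
ordinals below `l`. -/
def ordTrace (l : Ordinal.{u}) (S : ZFSet.{u}) : Set (Set.Iio l) := {a | a.1.toZFSet ∈ S}

/-- `S` is stationary in `l`: it meets every club subset of `l`. -/
def IsStationaryIn (l : Ordinal.{u}) (S : ZFSet.{u}) : Prop := IsStationary (ordTrace l S)

/-- `cof(ω) ∩ l`, the set of ordinals below `l` of cofinality `ω` (computed in V). -/
noncomputable def cofOmega (l : Ordinal.{u}) : ZFSet.{u} :=
  l.toZFSet.sep fun x => ∃ a : Ordinal.{u}, x = a.toZFSet ∧ a.cof = ℵ₀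

/-- The club filter on `l` restricted to `S`:
the set of `X ⊆ S` that contain `C ∩ S` for some club `C ⊆ l`. -/
noncomputable def clubFilterOn (l : Ordinal.{u}) (S : ZFSet.{u}) : ZFSet.{u} :=
  S.powerset.sep fun X => ∃ C : Set (Set.Iio l), IsClub C ∧ C ∩ ordTrace l S ⊆ ordTrace l X

/-- `⟨S_a | a < k⟩` is a partition of `cof(ω) ∩ l` into sets that are stationary in `l`. -/
structure IsStationaryPartition (l k : Ordinal.{u}) (S : Set.Iio k → ZFSet.{u}) : Prop where
  stationary : ∀ a, IsStationaryIn l (S a)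
  disjoint : ∀ a b, a ≠ b → ∀ x, x ∈ S a → x ∉ S b
  cover : ∀ x, x ∈ cofOmega l ↔ ∃ a, x ∈ S a

/-- The sequence `⟨S_a | a < k⟩` as a set, that is, the function `{(a, S_a) | a < k}`. -/
noncomputable def seqGraph (k : Ordinal.{u}) (S : Set.Iio k → ZFSet.{u}) : ZFSet.{u} :=
  ZFSet.range fun a : Set.Iio k => ZFSet.pair a.1.toZFSet (S a)

/-- For `l` an uncountable regular cardinal: `l` is `ω`-strongly measurable in HOD. There is
`0 < k < l` such that `(2 ^ k)^HOD < l` and no partition of `cof(ω) ∩ l` into `k` many stationary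
sets belongs to HOD. -/
def IsOmegaStronglyMeasurableInHOD (l : Cardinal.{u}) : Prop :=
  ∃ k : Ordinal.{u}, 0 < k ∧ k < l.ord ∧
    (∃ m : Ordinal.{u}, m < l.ord ∧ SetModel.IsTwoPow HOD.mem (HOD.ord m) (HOD.ord k)) ∧
    ¬ ∃ S : Set.Iio k → ZFSet.{u}, IsStationaryPartition l.ord k S ∧ seqGraph k S ∈ HOD

/-!
Suppose that `l` is `ω`-strongly measurable in HOD, as witnessed by `k`. The proof has two parts.

Some ordinal definable stationary `S ⊆ cof(ω) ∩ l` is *unsplittable*: it is not the union of two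
disjoint ordinal definable stationary sets (`exists_unsplittable`). Otherwise an ordinal definable
function `H` chooses a splitting of every ordinal definable stationary set, and it generates an
ordinal definable tree of subsets of `cof(ω) ∩ l`: at each successor level a node is split into two
halves, and at limit levels intersections are taken. The node of `x` at level `a ≤ k` is determined
by `a` and the set of left turns before `a`, a subset of `k` that lies in HOD. As `(2 ^ k)^HOD < l`,
there are fewer than `l` nodes below level `k`. A union of fewer than `l` nonstationary sets is
nonstationary, so some `x` lies in stationary nodes only (`exists_stationary_branch`). At each level
`a < k` the half not containing `x` is a stationary set that leaves the branch, and these `k`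
disjoint sets, with the remainder added to the first one, form a partition in HOD
(`exists_partition_of_split`) that the hypothesis excludes.

For an unsplittable `S`, the sets `X` in HOD with `S \ X` nonstationary form the required
ultrafilters, on `S` and, taking `X ⊆ l`, on `l` itself: given an ordinal definable `X`, one of
`S ∩ X` and `S \ X` is nonstationary, completeness is the completeness of the nonstationary ideal in
V, and singletons are nonstationary.

The metamathematical part is to show that the sets above are ordinal definable. Here `IsOD` asks for
a definition over one level of the cumulative hierarchy. It is shown to be equivalent to being
generated from ordinals by a fixed finite list of operations `Op`, which include the levels `V_a`
and enough relational algebra to evaluate formulas (`hasVal_realize`). A term in these operations is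
coded by a single ordinal, through Gödel pairing, and that an ordinal codes a set is recognized
correctly by all sufficiently large limit levels (`ValIn.sound`, `Val.complete`). Consequently an
ordinal definable set is definable over *every* sufficiently large limit level (`EvDfn`),
definitions can be composed (`isOD_of_dfn`), the relation "`x` is ordinal definable" is itself
available in definitions (`isOD_sep_isOD`), and least codes give the choice function `H` (`isOD_uniformize`).
-/

namespace OrdDef

variable {θ : Ordinal.{u}} {α β : Type}

/-! ### Definability over a level of the cumulative hierarchy -/

section Definability

open FirstOrder FirstOrder.Language

/-- `P` is definable over `(V_θ, ∈)` from ordinal parameters. This is a class, so that the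
definability of a predicate can be read off from its shape by instance search: the instances below
close it under connectives, quantifiers over `V_θ`, bounded quantifiers, and pairing. -/
class Dfn {θ : Ordinal.{u}} {α : Type} (P : (α → levelSet θ) → Prop) : Prop where
  out : Set.Definable {p : levelSet θ | (p : ZFSet.{u}).IsOrdinal} setLang {v | P v}

/-- Instance search does not unfold the predicate, so a predicate whose shape is not covered by the
instances is first replaced by an equivalent one. -/
theorem Dfn.congr {P Q : (α → levelSet θ) → Prop} (h : Dfn P) (hPQ : ∀ v, Q v ↔ P v) : Dfn Q := by
  have : P = Q := funext fun v => propext (hPQ v).symm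
  exact this ▸ h

theorem Dfn.comp {P : (α → levelSet θ) → Prop} (h : Dfn P) (f : α → β) :
    Dfn fun v : β → levelSet θ => P fun a => v (f a) :=
  ⟨h.out.preimage_comp f⟩

instance Dfn.and {P Q : (α → levelSet θ) → Prop} [hP : Dfn P] [hQ : Dfn Q] :
    Dfn fun v => P v ∧ Q v := ⟨hP.out.inter hQ.out⟩

instance Dfn.or {P Q : (α → levelSet θ) → Prop} [hP : Dfn P] [hQ : Dfn Q] :
    Dfn fun v => P v ∨ Q v := ⟨hP.out.union hQ.out⟩

instance Dfn.not {P : (α → levelSet θ) → Prop} [hP : Dfn P] :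
    Dfn fun v => ¬ P v := ⟨hP.out.compl⟩

instance Dfn.imp {P Q : (α → levelSet θ) → Prop} [hP : Dfn P] [hQ : Dfn Q] :
    Dfn fun v => P v → Q v :=
  (inferInstance : Dfn fun v => ¬ P v ∨ Q v).congr fun _ => imp_iff_not_or

instance Dfn.iff {P Q : (α → levelSet θ) → Prop} [hP : Dfn P] [hQ : Dfn Q] :
    Dfn fun v => (P v ↔ Q v) :=
  (inferInstance : Dfn fun v => (P v → Q v) ∧ (Q v → P v)).congr fun _ => iff_iff_implies_and_implies

instance Dfn.ex {Q : (α → levelSet θ) → levelSet θ → Prop}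
    [h : Dfn fun w : Option α → levelSet θ => Q (fun a => w (some a)) (w none)] :
    Dfn fun v => ∃ x, Q v x := by
  have h1 := (h.comp (fun o : Option α => (o.elim (Sum.inr 0) Sum.inl : α ⊕ Fin 1))).out
  refine Dfn.congr ⟨h1.exists_of_finite⟩ fun v => ?_
  exact ⟨fun ⟨x, hx⟩ => ⟨fun _ => x, hx⟩, fun ⟨u, hu⟩ => ⟨u 0, hu⟩⟩

instance Dfn.all {Q : (α → levelSet θ) → levelSet θ → Prop}
    [h : Dfn fun w : Option α → levelSet θ => Q (fun a => w (some a)) (w none)] :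
    Dfn fun v => ∀ x, Q v x :=
  (inferInstance : Dfn fun v => ¬ ∃ x, ¬ Q v x).congr fun v => by simp

instance Dfn.finiteEx {ι : Type} [Finite ι] {Q : ι → (α → levelSet θ) → Prop}
    [h : ∀ k, Dfn (Q k)] : Dfn fun v => ∃ k, Q k v :=
  Dfn.congr ⟨Set.definable_iUnion_of_finite fun k => (h k).out⟩ fun _ => Set.mem_iUnion.symm

instance Dfn.mem (i j : α) : Dfn fun v : α → levelSet θ => (v i).1 ∈ (v j).1 := by
  refine ⟨Set.Definable.mono (Set.empty_definable_iff.2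
    ⟨Relations.formula₂ (L := setLang) MemSymbol.mem (Term.var i) (Term.var j), ?_⟩)
    (Set.empty_subset _)⟩
  ext v
  simp only [Set.mem_ofPred_eq]
  rfl

instance Dfn.eq (i j : α) : Dfn fun v : α → levelSet θ => (v i).1 = (v j).1 := by
  refine ⟨Set.Definable.mono (Set.empty_definable_iff.2
    ⟨(Term.var i).equal (Term.var j), ?_⟩) (Set.empty_subset _)⟩
  ext v
  simp [Subtype.ext_iff]

theorem Dfn.eqConst {p : levelSet θ} (hp : p.1.IsOrdinal) (i : α) :
    Dfn fun v : α → levelSet θ => (v i).1 = p.1 := by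
  have h := Set.Definable.singleton_of_mem setLang
    (show p ∈ {p : levelSet θ | (p : ZFSet.{u}).IsOrdinal} from hp)
  exact (Dfn.comp (P := fun v : Fin 1 → levelSet θ => v 0 ∈ ({p} : Set _)) ⟨h⟩ fun _ => i).congr
    fun v => by simp [Subtype.ext_iff]

instance Dfn.false : Dfn fun _ : α → levelSet θ => False :=
  Dfn.congr (P := fun v => v ∈ (∅ : Set (α → levelSet θ))) ⟨Set.definable_empty⟩ fun v => by simp

theorem mem_lev_of_mem {x y : ZFSet.{u}} (hy : y ∈ levelSet θ) (h : x ∈ y) : x ∈ levelSet θ :=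
  (ZFSet.isTransitive_vonNeumann θ).mem_trans h hy

theorem pair_mem_lev {x y f : ZFSet.{u}} (hf : f ∈ levelSet θ) (h : ZFSet.pair x y ∈ f) :
    x ∈ levelSet θ ∧ y ∈ levelSet θ := by
  have h1 := mem_lev_of_mem hf h
  have h2 : ({x, y} : ZFSet) ∈ levelSet θ := mem_lev_of_mem h1 (by simp [ZFSet.pair])
  exact ⟨mem_lev_of_mem h2 (by simp), mem_lev_of_mem h2 (by simp)⟩

/-- An ordinal outside `V_θ` defines the empty predicate, so no bound on `o` is needed. -/
instance Dfn.eqOrd (o : Ordinal.{u}) (i : α) :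
    Dfn fun v : α → levelSet θ => (v i).1 = o.toZFSet := by
  by_cases ho : o.toZFSet ∈ levelSet θ
  · exact Dfn.eqConst (p := ⟨_, ho⟩) (ZFSet.isOrdinal_toZFSet o) i
  · exact Dfn.false.congr fun v => ⟨fun h => ho (h ▸ (v i).2), False.elim⟩

/-- Bounded quantifiers may range over all sets, as `V_θ` is transitive. -/
instance Dfn.bex {Q : (α → levelSet θ) → ZFSet.{u} → Prop} (i : α)
    [h : Dfn fun w : Option α → levelSet θ => Q (fun a => w (some a)) (w none).1] :
    Dfn fun v => ∃ x, x ∈ (v i).1 ∧ Q v x :=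
  (inferInstance : Dfn fun v => ∃ x : levelSet θ, x.1 ∈ (v i).1 ∧ Q v x.1).congr fun v =>
    ⟨fun ⟨x, hx, hq⟩ => ⟨⟨x, mem_lev_of_mem (v i).2 hx⟩, hx, hq⟩, fun ⟨x, hx⟩ => ⟨x.1, hx⟩⟩

instance Dfn.ball {Q : (α → levelSet θ) → ZFSet.{u} → Prop} (i : α)
    [h : Dfn fun w : Option α → levelSet θ => Q (fun a => w (some a)) (w none).1] :
    Dfn fun v => ∀ x, x ∈ (v i).1 → Q v x :=
  (inferInstance : Dfn fun v => ∀ x : levelSet θ, x.1 ∈ (v i).1 → Q v x.1).congr fun v =>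
    ⟨fun h x hx => h x hx, fun h x hx => h ⟨x, mem_lev_of_mem (v i).2 hx⟩ hx⟩

instance Dfn.subset (i j : α) : Dfn fun v : α → levelSet θ => (v i).1 ⊆ (v j).1 :=
  (inferInstance : Dfn fun v : α → levelSet θ => ∀ x, x ∈ (v i).1 → x ∈ (v j).1).congr
    fun _ => Iff.rfl

instance Dfn.eqUPair (i j k : α) :
    Dfn fun v : α → levelSet θ => (v i).1 = ({(v j).1, (v k).1} : ZFSet) :=
  (inferInstance : Dfn fun v : α → levelSet θ => (∀ x, x ∈ (v i).1 → x = (v j).1 ∨ x = (v k).1) ∧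
    (v j).1 ∈ (v i).1 ∧ (v k).1 ∈ (v i).1).congr fun v => by
      constructor
      · intro h; rw [h]; simp
      · rintro ⟨h1, h2, h3⟩
        ext z; rw [ZFSet.mem_pair]
        exact ⟨h1 z, by rintro (rfl | rfl) <;> assumption⟩

instance Dfn.eqPair (i j k : α) :
    Dfn fun v : α → levelSet θ => (v i).1 = ZFSet.pair (v j).1 (v k).1 :=
  (inferInstance : Dfn fun v : α → levelSet θ => ∃ a b : levelSet θ, a.1 = ({(v j).1, (v j).1} : ZFSet)
      ∧ b.1 = ({(v j).1, (v k).1} : ZFSet) ∧ (v i).1 = ({a.1, b.1} : ZFSet)).congr fun v => by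
    constructor
    · intro h
      have h1 : ({(v j).1} : ZFSet) ∈ (v i).1 := by rw [h]; simp [ZFSet.pair]
      have h2 : ({(v j).1, (v k).1} : ZFSet) ∈ (v i).1 := by rw [h]; simp [ZFSet.pair]
      exact ⟨⟨_, mem_lev_of_mem (v i).2 h1⟩, ⟨_, mem_lev_of_mem (v i).2 h2⟩, by simp, rfl, h⟩
    · rintro ⟨a, b, ha, hb, h⟩
      rw [h, ha, hb, ZFSet.pair_eq_singleton]; rfl

instance Dfn.pairMem (i j k : α) :
    Dfn fun v : α → levelSet θ => ZFSet.pair (v j).1 (v k).1 ∈ (v i).1 :=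
  (inferInstance : Dfn fun v : α → levelSet θ => ∃ x, x ∈ (v i).1 ∧ x = ZFSet.pair (v j).1 (v k).1).congr
    fun v => by simp

/-- Quantifiers over the pairs in an element of `V_θ` stay inside `V_θ`. -/
instance Dfn.pex {Q : (α → levelSet θ) → ZFSet.{u} → ZFSet.{u} → Prop} (i : α)
    [h : Dfn fun w : Option (Option α) → levelSet θ =>
      Q (fun a => w (some (some a))) (w (some none)).1 (w none).1] :
    Dfn fun v => ∃ x y, ZFSet.pair x y ∈ (v i).1 ∧ Q v x y :=
  (inferInstance : Dfn fun v => ∃ x y : levelSet θ, ZFSet.pair x.1 y.1 ∈ (v i).1 ∧ Q v x.1 y.1).congr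
    fun v => ⟨fun ⟨x, y, hx, hq⟩ => ⟨⟨x, (pair_mem_lev (v i).2 hx).1⟩,
      ⟨y, (pair_mem_lev (v i).2 hx).2⟩, hx, hq⟩, fun ⟨x, y, hx⟩ => ⟨x.1, y.1, hx⟩⟩

instance Dfn.pall {Q : (α → levelSet θ) → ZFSet.{u} → ZFSet.{u} → Prop} (i : α)
    [h : Dfn fun w : Option (Option α) → levelSet θ =>
      Q (fun a => w (some (some a))) (w (some none)).1 (w none).1] :
    Dfn fun v => ∀ x y, ZFSet.pair x y ∈ (v i).1 → Q v x y :=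
  (inferInstance : Dfn fun v => ∀ x y : levelSet θ, ZFSet.pair x.1 y.1 ∈ (v i).1 → Q v x.1 y.1).congr
    fun v => ⟨fun h x y hx => h x y hx, fun h x y hx => h ⟨x, (pair_mem_lev (v i).2 hx).1⟩
      ⟨y, (pair_mem_lev (v i).2 hx).2⟩ hx⟩

instance Dfn.isOrdinal (i : α) : Dfn fun v : α → levelSet θ => (v i).1.IsOrdinal :=
  (inferInstance : Dfn fun v : α → levelSet θ => (∀ x, x ∈ (v i).1 → x ⊆ (v i).1) ∧
    ∀ x, x ∈ (v i).1 → ∀ y, y ∈ x → y ⊆ x).congr fun _ =>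
      ZFSet.isOrdinal_iff_forall_mem_isTransitive

instance Dfn.eqTriple (i j k l : α) :
    Dfn fun v : α → levelSet θ => (v i).1 = ZFSet.pair (ZFSet.pair (v j).1 (v k).1) (v l).1 :=
  (inferInstance : Dfn fun v : α → levelSet θ => ∃ p : levelSet θ,
    p.1 = ZFSet.pair (v j).1 (v k).1 ∧ (v i).1 = ZFSet.pair p.1 (v l).1).congr fun v => by
    constructor
    · intro h
      have h1 : ({ZFSet.pair (v j).1 (v k).1} : ZFSet) ∈ (v i).1 := by rw [h]; simp [ZFSet.pair]
      exact ⟨⟨_, mem_lev_of_mem (mem_lev_of_mem (v i).2 h1) (ZFSet.mem_singleton.2 rfl)⟩, rfl, h⟩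
    · rintro ⟨p, hp, h⟩
      rw [h, hp]

instance Dfn.tripleMem (i j k l : α) :
    Dfn fun v : α → levelSet θ => ZFSet.pair (ZFSet.pair (v j).1 (v k).1) (v l).1 ∈ (v i).1 :=
  (inferInstance : Dfn fun v : α → levelSet θ => ∃ p q, ZFSet.pair p q ∈ (v i).1 ∧
    p = ZFSet.pair (v j).1 (v k).1 ∧ q = (v l).1).congr fun v => by simp

end Definability

/-! ### Ranks -/

theorem mem_lev {x : ZFSet.{u}} : x ∈ levelSet θ ↔ x.rank < θ := ZFSet.mem_vonNeumann

theorem rank_pair_lt {x y : ZFSet.{u}} {b : Ordinal.{u}} (hx : x.rank < b) (hy : y.rank < b) :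
    (ZFSet.pair x y).rank < b + 2 := by
  have h1 := Order.succ_le_of_lt hx
  have h2 := Order.succ_le_of_lt hy
  have : b + 2 = Order.succ (Order.succ b) := by
    rw [← one_add_one_eq_two, ← add_assoc]; rfl
  rw [this]
  simp [ZFSet.pair, hx, hy]

theorem rank_lt_of_pair {x y : ZFSet.{u}} :
    x.rank < (ZFSet.pair x y).rank ∧ y.rank < (ZFSet.pair x y).rank := by
  have h : ({x, y} : ZFSet).rank < (ZFSet.pair x y).rank := ZFSet.rank_lt_of_mem (by simp [ZFSet.pair])
  exact ⟨(ZFSet.rank_lt_of_mem (by simp)).trans h, (ZFSet.rank_lt_of_mem (by simp)).trans h⟩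

theorem add_nat_lt (hθ : Order.IsSuccLimit θ) {o : Ordinal.{u}} (ho : o < θ) (n : ℕ) : o + n < θ := by
  induction n with
  | zero => simpa
  | succ n ih =>
    rw [Nat.cast_succ, ← add_assoc]
    exact hθ.succ_lt ih

/-- An inequality of ranks is witnessed inside `V_θ` by a simulation `r`: the set of pairs `(y, d)`
with `rank y ≤ rank d`, for `y` and `d` of rank at most that of `c`. -/
theorem exists_rank_certificate [hθ : Fact (Order.IsSuccLimit θ)] (w c : levelSet θ)
    (h : w.1.rank ≤ c.1.rank) :
    ∃ r : levelSet θ, ZFSet.pair w.1 c.1 ∈ r.1 ∧ ∀ y d, ZFSet.pair y d ∈ r.1 →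
      ∀ y', y' ∈ y → ∃ d', d' ∈ d ∧ ZFSet.pair y' d' ∈ r.1 := by
  have hc := mem_lev.1 c.2
  set b := c.1.rank + 1 with hb
  set r := ((ZFSet.vonNeumann b).prod (ZFSet.vonNeumann b)).sep
    fun p => ∃ y d, p = ZFSet.pair y d ∧ y.rank ≤ d.rank with hr
  have hmem : ∀ y d, ZFSet.pair y d ∈ r ↔ y.rank < b ∧ d.rank < b ∧ y.rank ≤ d.rank := by
    intro y d
    simp only [hr, ZFSet.mem_sep, ZFSet.pair_mem_prod, ZFSet.mem_vonNeumann]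
    constructor
    · rintro ⟨⟨h1, h2⟩, y', d', e, h3⟩
      obtain ⟨rfl, rfl⟩ := ZFSet.pair_injective e
      exact ⟨h1, h2, h3⟩
    · rintro ⟨h1, h2, h3⟩
      exact ⟨⟨h1, h2⟩, y, d, rfl, h3⟩
  have hrank : r.rank < θ := by
    refine lt_of_le_of_lt ((ZFSet.rank_le_iff (o := b + 2)).2 fun p hp => ?_) ?_
    · obtain ⟨hp, -⟩ := ZFSet.mem_sep.1 hp
      obtain ⟨y, hy, d, hd, rfl⟩ := ZFSet.mem_prod.1 hp
      exact rank_pair_lt (ZFSet.mem_vonNeumann.1 hy) (ZFSet.mem_vonNeumann.1 hd)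
    · exact_mod_cast add_nat_lt hθ.1 (add_nat_lt hθ.1 hc 1 : _ + ((1:ℕ) : Ordinal) < θ) 2
  refine ⟨⟨r, mem_lev.2 hrank⟩, (hmem _ _).2 ⟨?_, ?_, h⟩, fun y d hyd y' hy' => ?_⟩
  · exact Order.lt_add_one_iff.2 h
  · exact Order.lt_add_one_iff.2 le_rfl
  · obtain ⟨h1, h2, h3⟩ := (hmem _ _).1 hyd
    obtain ⟨d', hd', hle⟩ := ZFSet.lt_rank_iff.1 ((ZFSet.rank_lt_of_mem hy').trans_le h3)
    exact ⟨d', hd', (hmem _ _).2 ⟨(ZFSet.rank_lt_of_mem hy').trans h1,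
      (ZFSet.rank_lt_of_mem hd').trans h2, hle⟩⟩

/-- Any simulation bounds ranks, which is the converse of `exists_rank_certificate`. -/
theorem rank_le_of_certificate {r : ZFSet.{u}} (hr : ∀ y d, ZFSet.pair y d ∈ r →
    ∀ y', y' ∈ y → ∃ d', d' ∈ d ∧ ZFSet.pair y' d' ∈ r) (y : ZFSet.{u}) :
    ∀ d, ZFSet.pair y d ∈ r → y.rank ≤ d.rank := by
  induction y using ZFSet.inductionOn with
  | h y ih =>
    intro d hd
    refine ZFSet.rank_le_iff.2 fun y' hy' => ?_
    obtain ⟨d', hd', h⟩ := hr y d hd y' hy'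
    exact (ih y' hy' d' h).trans_lt (ZFSet.rank_lt_of_mem hd')

instance Dfn.rankLT [hθ : Fact (Order.IsSuccLimit θ)] (i j : α) :
    Dfn fun v : α → levelSet θ => (v i).1.rank < (v j).1.rank :=
  (inferInstance : Dfn fun v : α → levelSet θ => ∃ c : levelSet θ, c.1 ∈ (v j).1 ∧
    ∃ r : levelSet θ, ZFSet.pair (v i).1 c.1 ∈ r.1 ∧ ∀ y d, ZFSet.pair y d ∈ r.1 →
      ∀ y', y' ∈ y → ∃ d', d' ∈ d ∧ ZFSet.pair y' d' ∈ r.1).congr fun v => by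
    rw [ZFSet.lt_rank_iff]
    constructor
    · rintro ⟨c, hc, h⟩
      exact ⟨⟨c, mem_lev_of_mem (v j).2 hc⟩, hc, exists_rank_certificate _ ⟨c, _⟩ h⟩
    · rintro ⟨c, hc, r, h1, h2⟩
      exact ⟨c.1, hc, rank_le_of_certificate h2 _ _ h1⟩

/-! ### A finite list of set operations -/

/-- The operations from which every ordinal definable set is generated, starting from ordinals.
`level` is `V_α` for `α = rank x`, and `proj`, `lift`, `memRel`, `eqRel`, `ran`, `prod` and `diff`
serve to build the satisfaction relation of a formula; `upair` and `union` handle singletons. -/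
inductive Op
  | level | prod | diff | upair | proj | lift | memRel | eqRel | ran | union

/-- A numbering of the operations. -/
def Op.idx : Op → Fin 10
  | level => 0 | prod => 1 | diff => 2 | upair => 3 | proj => 4 | lift => 5 | memRel => 6
  | eqRel => 7 | ran => 8 | union => 9

theorem Op.idx_injective : Function.Injective Op.idx := by
  rintro ⟨⟩ ⟨⟩ h <;> first | rfl | exact absurd h (by decide)

instance : Finite Op := Finite.of_injective _ Op.idx_injective

open ZFSet (pair) in
/-- `w` is an element of the result of the operation at `x` and `y`. Unary operations ignore `y`.
Relations between assignments and values are sets of pairs `(e, b)`; the projection pairs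
`((a, e), a)` evaluate the newest variable of an assignment, and `lift` extends an evaluation to longer
assignments. -/
def Op.Mem (w x y : ZFSet.{u}) : Op → Prop
  | level => w.rank < x.rank
  | prod => ∃ a, a ∈ x ∧ ∃ b, b ∈ y ∧ w = pair a b
  | diff => w ∈ x ∧ w ∉ y
  | upair => w = x ∨ w = y
  | proj => ∃ a, a ∈ x ∧ ∃ e, e ∈ y ∧ w = pair (pair a e) a
  | lift => ∃ a, a ∈ x ∧ ∃ e b, pair e b ∈ y ∧ w = pair (pair a e) b
  | memRel => ∃ e a, pair e a ∈ x ∧ ∃ e' b, pair e' b ∈ y ∧ w = e ∧ w = e' ∧ a ∈ b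
  | eqRel => ∃ e a, pair e a ∈ x ∧ ∃ e' b, pair e' b ∈ y ∧ w = e ∧ w = e' ∧ a = b
  | ran => ∃ a b, pair a b ∈ x ∧ w = b
  | union => ∃ z, z ∈ x ∧ w ∈ z

theorem Op.Mem.rank_lt {w x y : ZFSet.{u}} {k : Op} (h : k.Mem w x y) :
    w.rank < max x.rank y.rank + 4 := by
  set m := max x.rank y.rank with hm
  have hx : x.rank ≤ m := le_max_left _ _
  have hy : y.rank ≤ m := le_max_right _ _
  have mx : ∀ {a}, a ∈ x → a.rank < m := fun h => (ZFSet.rank_lt_of_mem h).trans_le hx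
  have my : ∀ {a}, a ∈ y → a.rank < m := fun h => (ZFSet.rank_lt_of_mem h).trans_le hy
  have px : ∀ {a b}, ZFSet.pair a b ∈ x → a.rank < m ∧ b.rank < m := fun h =>
    ⟨rank_lt_of_pair.1.trans (mx h), rank_lt_of_pair.2.trans (mx h)⟩
  have py : ∀ {a b}, ZFSet.pair a b ∈ y → a.rank < m ∧ b.rank < m := fun h =>
    ⟨rank_lt_of_pair.1.trans (my h), rank_lt_of_pair.2.trans (my h)⟩
  have h4 : m + 2 + 2 = m + 4 := by rw [add_assoc]; norm_num
  have e2 : m ≤ m + 2 := le_add_of_nonneg_right zero_le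
  have l2 : m + 2 ≤ m + 4 := h4 ▸ le_add_of_nonneg_right zero_le
  have l0 : m < m + 4 := by
    simp
  cases k with
  | level => exact (lt_of_lt_of_le h hx).trans l0
  | prod =>
    obtain ⟨a, ha, b, hb, rfl⟩ := h
    exact (rank_pair_lt (mx ha) (my hb)).trans_le l2
  | diff => exact (mx h.1).trans l0
  | upair =>
    obtain rfl | rfl := h
    · exact hx.trans_lt l0
    · exact hy.trans_lt l0
  | proj =>
    obtain ⟨a, ha, b, hb, rfl⟩ := h
    exact h4 ▸ rank_pair_lt (rank_pair_lt (mx ha) (my hb)) ((mx ha).trans_le e2)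
  | lift =>
    obtain ⟨a, ha, e, b, hb, rfl⟩ := h
    exact h4 ▸ rank_pair_lt (rank_pair_lt (mx ha) (py hb).1) ((py hb).2.trans_le e2)
  | memRel =>
    obtain ⟨e, a, ha, -, -, -, rfl, -⟩ := h
    exact (px ha).1.trans l0
  | eqRel =>
    obtain ⟨e, a, ha, -, -, -, rfl, -⟩ := h
    exact (px ha).1.trans l0
  | ran =>
    obtain ⟨a, b, ha, rfl⟩ := h
    exact (px ha).2.trans l0
  | union =>
    obtain ⟨z, hz, hw⟩ := h
    exact ((ZFSet.rank_lt_of_mem hw).trans (mx hz)).trans l0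

/-- The value of the operation `k`. The separation from a level only serves to make it a set, by
`Op.Mem.rank_lt`. -/
noncomputable def Op.app (k : Op) (x y : ZFSet.{u}) : ZFSet.{u} :=
  (ZFSet.vonNeumann (max x.rank y.rank + 4)).sep fun w => k.Mem w x y

@[simp] theorem Op.mem_app {k : Op} {w x y : ZFSet.{u}} : w ∈ k.app x y ↔ k.Mem w x y := by
  rw [Op.app, ZFSet.mem_sep, ZFSet.mem_vonNeumann]
  exact ⟨And.right, fun h => ⟨h.rank_lt, h⟩⟩

instance Op.dfnMem [Fact (Order.IsSuccLimit θ)] (k : Op) (i j l : α) :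
    Dfn fun v : α → levelSet θ => k.Mem (v i).1 (v j).1 (v l).1 := by
  cases k <;> dsimp only [Op.Mem] <;> infer_instance

theorem Op.eq_app_iff [hθ : Fact (Order.IsSuccLimit θ)] (k : Op) (z x y : levelSet θ) :
    z.1 = k.app x.1 y.1 ↔ ∀ w : levelSet θ, w.1 ∈ z.1 ↔ k.Mem w.1 x.1 y.1 := by
  constructor
  · intro h w; rw [h, Op.mem_app]
  · intro h
    ext w
    rw [Op.mem_app]
    constructor
    · intro hw
      exact (h ⟨w, mem_lev_of_mem z.2 hw⟩).1 hw
    · intro hw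
      have : w ∈ levelSet θ := mem_lev.2 <| hw.rank_lt.trans
        (by exact_mod_cast add_nat_lt hθ.1 (max_lt (mem_lev.1 x.2) (mem_lev.1 y.2)) 4)
      exact (h ⟨w, this⟩).2 hw

instance Op.dfnApp [Fact (Order.IsSuccLimit θ)] (k : Op) (i j l : α) :
    Dfn fun v : α → levelSet θ => (v i).1 = k.app (v j).1 (v l).1 :=
  (inferInstance : Dfn fun v : α → levelSet θ => ∀ w : levelSet θ,
    w.1 ∈ (v i).1 ↔ k.Mem w.1 (v j).1 (v l).1).congr fun _ => k.eq_app_iff _ _ _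

/-! ### Gödel pairing of ordinals -/

/-- The sort key of the Gödel well-order of pairs of ordinals: the maximum, then the components. -/
noncomputable def pairKey (p : Ordinal.{u} × Ordinal.{u}) : Ordinal.{u} ×ₗ Ordinal.{u} ×ₗ Ordinal.{u} :=
  toLex (max p.1 p.2, toLex p)

theorem pairKey_injective : Function.Injective pairKey.{u} := by
  intro p q h
  simp only [pairKey, toLex_inj, Prod.mk.injEq] at h
  exact h.2

theorem pairKey_lt_iff {a b c d : Ordinal.{u}} : pairKey (a, b) < pairKey (c, d) ↔
    max a b < max c d ∨ max a b = max c d ∧ (a < c ∨ a = c ∧ b < d) := by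
  simp [pairKey, Prod.Lex.toLex_lt_toLex]

theorem max_le_of_pairKey_lt {p q : Ordinal.{u} × Ordinal.{u}} (h : pairKey p < pairKey q) :
    max p.1 p.2 ≤ max q.1 q.2 := by
  obtain h | ⟨h, -⟩ := pairKey_lt_iff.1 h
  exacts [h.le, h.le]

instance small_pairKey (p : Ordinal.{u} × Ordinal.{u}) :
    Small.{u} {q : Ordinal.{u} × Ordinal.{u} // pairKey q < pairKey p} := by
  let m := max p.1 p.2
  refine small_of_injective (β := Set.Iic m × Set.Iic m) (f := fun q =>
    (⟨q.1.1, (le_max_left _ _).trans (max_le_of_pairKey_lt q.2)⟩,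
      ⟨q.1.2, (le_max_right _ _).trans (max_le_of_pairKey_lt q.2)⟩)) ?_
  rintro ⟨⟨a, b⟩, h⟩ ⟨⟨c, d⟩, h'⟩ e
  simp only [Prod.mk.injEq] at e
  exact Subtype.ext (Prod.ext (congrArg Subtype.val e.1) (congrArg Subtype.val e.2))

/-- The Gödel pairing of ordinals: the position of a pair in the order given by `pairKey`. -/
noncomputable def pairIdx (p : Ordinal.{u} × Ordinal.{u}) : Ordinal.{u} :=
  ⨆ q : {q : Ordinal.{u} × Ordinal.{u} // pairKey q < pairKey p}, pairIdx q.1 + 1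
termination_by pairKey p
decreasing_by exact q.2

theorem lt_pairIdx_iff {p : Ordinal.{u} × Ordinal.{u}} {o : Ordinal.{u}} :
    o < pairIdx p ↔ ∃ q, pairKey q < pairKey p ∧ o ≤ pairIdx q := by
  rw [pairIdx, Ordinal.lt_iSup_iff]
  simp

theorem pairIdx_lt {p q : Ordinal.{u} × Ordinal.{u}} (h : pairKey p < pairKey q) :
    pairIdx p < pairIdx q := lt_pairIdx_iff.2 ⟨p, h, le_rfl⟩

theorem pairIdx_injective : Function.Injective pairIdx.{u} := by
  intro p q h
  obtain h' | h' | h' := lt_trichotomy (pairKey p) (pairKey q)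
  · exact absurd h (pairIdx_lt h').ne
  · exact pairKey_injective h'
  · exact absurd h (pairIdx_lt h').ne'

theorem le_pairIdx_left (a b : Ordinal.{u}) : a ≤ pairIdx (a, b) := by
  refine StrictMono.le_apply (f := fun a => pairIdx (a, b)) fun c d h => pairIdx_lt ?_
  rw [pairKey_lt_iff]
  obtain h' | h' := (max_le_max_right b h.le).lt_or_eq
  · exact Or.inl h'
  · exact Or.inr ⟨h', Or.inl h⟩

theorem le_pairIdx_right (a b : Ordinal.{u}) : b ≤ pairIdx (a, b) := by
  refine StrictMono.le_apply (f := fun b => pairIdx (a, b)) fun c d h => pairIdx_lt ?_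
  rw [pairKey_lt_iff]
  obtain h' | h' := (max_le_max_left a h.le).lt_or_eq
  · exact Or.inl h'
  · exact Or.inr ⟨h', Or.inr ⟨rfl, h⟩⟩

theorem lt_pairIdx_of_pos {a : Ordinal.{u}} (ha : 0 < a) (b : Ordinal.{u}) : b < pairIdx (a, b) := by
  refine (le_pairIdx_right 0 b).trans_lt (pairIdx_lt ?_)
  rw [pairKey_lt_iff]
  obtain h' | h' := (max_le_max_right b ha.le).lt_or_eq
  · exact Or.inl h'
  · exact Or.inr ⟨h', Or.inl ha⟩

/-- The order of pairs given by `pairKey`, as a formula about von Neumann ordinals. -/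
def KeyLT (a b c d : ZFSet.{u}) : Prop :=
  ((a ∈ c ∧ b ∈ c) ∨ (a ∈ d ∧ b ∈ d)) ∨
    ¬ ((c ∈ a ∧ d ∈ a) ∨ (c ∈ b ∧ d ∈ b)) ∧ (a ∈ c ∨ a = c ∧ b ∈ d)

instance KeyLT.dfn (i j k l : α) :
    Dfn fun v : α → levelSet θ => KeyLT (v i).1 (v j).1 (v k).1 (v l).1 := by
  unfold KeyLT; infer_instance

theorem keyLT_iff {a b c d : Ordinal.{u}} :
    KeyLT a.toZFSet b.toZFSet c.toZFSet d.toZFSet ↔ pairKey (a, b) < pairKey (c, d) := by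
  simp only [KeyLT, Ordinal.toZFSet_mem_toZFSet_iff, Ordinal.toZFSet_injective.eq_iff,
    pairKey_lt_iff, ← max_lt_iff, ← lt_max_iff, not_lt]
  constructor
  · rintro (h | ⟨h, h'⟩)
    · exact Or.inl h
    · obtain h | h := h.lt_or_eq
      exacts [Or.inl h, Or.inr ⟨h, h'⟩]
  · rintro (h | ⟨h, h'⟩)
    exacts [Or.inl h, Or.inr ⟨h.le, h'⟩]

/-- `g` is a set of triples `((a, b), c)` closed enough to guarantee `c = pairIdx (a, b)`. -/
def PairCert (g : levelSet θ) : Prop :=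
  ∀ a b c : levelSet θ, ZFSet.pair (ZFSet.pair a.1 b.1) c.1 ∈ g.1 →
    (a.1.IsOrdinal ∧ b.1.IsOrdinal ∧ c.1.IsOrdinal) ∧
    (∀ e, e ∈ c.1 → ∃ a' b' c' : levelSet θ, ZFSet.pair (ZFSet.pair a'.1 b'.1) c'.1 ∈ g.1 ∧
      KeyLT a'.1 b'.1 a.1 b.1 ∧ (e = c'.1 ∨ e ∈ c'.1)) ∧
    ∀ a' b' : levelSet θ, a'.1.IsOrdinal → b'.1.IsOrdinal → KeyLT a'.1 b'.1 a.1 b.1 →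
      ∃ c' : levelSet θ, c'.1 ∈ c.1 ∧ ZFSet.pair (ZFSet.pair a'.1 b'.1) c'.1 ∈ g.1

instance PairCert.dfn (i : α) : Dfn fun v : α → levelSet θ => PairCert (v i) := by
  unfold PairCert; infer_instance

theorem ord_mem_lev {o : Ordinal.{u}} : o.toZFSet ∈ levelSet θ ↔ o < θ := by
  rw [mem_lev, Ordinal.rank_toZFSet]

theorem triple_mem_lev {a b c g : ZFSet.{u}} (hg : g ∈ levelSet θ)
    (h : ZFSet.pair (ZFSet.pair a b) c ∈ g) : a ∈ levelSet θ ∧ b ∈ levelSet θ ∧ c ∈ levelSet θ := by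
  obtain ⟨h1, h2⟩ := pair_mem_lev hg h
  have h3 : a.rank < θ ∧ b.rank < θ :=
    ⟨rank_lt_of_pair.1.trans (mem_lev.1 h1), rank_lt_of_pair.2.trans (mem_lev.1 h1)⟩
  exact ⟨mem_lev.2 h3.1, mem_lev.2 h3.2, h2⟩

theorem exists_toZFSet {x : ZFSet.{u}} (hx : x.IsOrdinal) : ∃ o : Ordinal.{u}, o.toZFSet = x :=
  ⟨_, hx.toZFSet_rank_eq⟩

/-- By induction along the order of pairs, a certificate can only contain correct triples. -/
theorem PairCert.eq_pairIdx {g : levelSet θ} (hg : PairCert g) (p : Ordinal.{u} × Ordinal.{u}) :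
    ∀ c : Ordinal.{u}, ZFSet.pair (ZFSet.pair p.1.toZFSet p.2.toZFSet) c.toZFSet ∈ g.1 →
      c = pairIdx p := by
  induction p using (InvImage.wf pairKey wellFounded_lt).induction with
  | _ p ih =>
    obtain ⟨a, b⟩ := p
    intro c hc
    obtain ⟨ha, hb, hc'⟩ := triple_mem_lev g.2 hc
    obtain ⟨-, h1, h2⟩ := hg ⟨_, ha⟩ ⟨_, hb⟩ ⟨_, hc'⟩ hc
    refine eq_of_forall_lt_iff fun e => ?_
    rw [lt_pairIdx_iff]
    constructor
    · intro he
      obtain ⟨a', b', c', h3, h4, h5⟩ := h1 _ (Ordinal.toZFSet_mem_toZFSet_iff.2 he)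
      obtain ⟨⟨oa, ob, oc⟩, -⟩ := hg a' b' c' h3
      obtain ⟨a'', ea⟩ := exists_toZFSet oa
      obtain ⟨b'', eb⟩ := exists_toZFSet ob
      obtain ⟨c'', ec⟩ := exists_toZFSet oc
      rw [← ea, ← eb, ← ec] at h3
      rw [← ea, ← eb] at h4
      rw [← ec] at h5
      have h6 := keyLT_iff.1 h4
      have h7 := ih (a'', b'') h6 c'' h3
      refine ⟨_, h6, h7 ▸ ?_⟩
      obtain h5 | h5 := h5
      · exact (Ordinal.toZFSet_injective h5).le
      · exact (Ordinal.toZFSet_mem_toZFSet_iff.1 h5).le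
    · rintro ⟨⟨a', b'⟩, hq, he⟩
      have hm := max_le_of_pairKey_lt hq
      have hl : max a b < θ := max_lt (ord_mem_lev.1 ha) (ord_mem_lev.1 hb)
      have ha' : a' < θ := ((le_max_left _ _).trans hm).trans_lt hl
      have hb' : b' < θ := ((le_max_right _ _).trans hm).trans_lt hl
      obtain ⟨c', h3, h4⟩ := h2 ⟨_, ord_mem_lev.2 ha'⟩ ⟨_, ord_mem_lev.2 hb'⟩
        (ZFSet.isOrdinal_toZFSet _) (ZFSet.isOrdinal_toZFSet _) (keyLT_iff.2 hq)
      obtain ⟨c'', hc'', e⟩ := Ordinal.mem_toZFSet_iff.1 h3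
      rw [← e] at h4
      exact (ih (a', b') hq _ h4 ▸ he).trans_lt hc''

/-- The graph of `pairIdx` on pairs of ordinals below `μ`. -/
noncomputable def pairGraph (μ : Ordinal.{u}) : ZFSet.{u} :=
  ZFSet.range fun p : Set.Iio μ × Set.Iio μ =>
    ZFSet.pair (ZFSet.pair p.1.1.toZFSet p.2.1.toZFSet) (pairIdx (p.1.1, p.2.1)).toZFSet

theorem mem_pairGraph {μ : Ordinal.{u}} {x y z : ZFSet.{u}} :
    ZFSet.pair (ZFSet.pair x y) z ∈ pairGraph μ ↔ ∃ a b : Ordinal.{u}, a < μ ∧ b < μ ∧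
      x = a.toZFSet ∧ y = b.toZFSet ∧ z = (pairIdx (a, b)).toZFSet := by
  rw [pairGraph, ZFSet.mem_range]
  constructor
  · rintro ⟨⟨⟨a, ha⟩, b, hb⟩, h⟩
    obtain ⟨h1, rfl⟩ := ZFSet.pair_injective h
    obtain ⟨rfl, rfl⟩ := ZFSet.pair_injective h1
    exact ⟨a, b, ha, hb, rfl, rfl, rfl⟩
  · rintro ⟨a, b, ha, hb, rfl, rfl, rfl⟩
    exact ⟨⟨⟨a, ha⟩, b, hb⟩, rfl⟩

theorem pairCert_pairGraph {μ : Ordinal.{u}} (h : pairGraph μ ∈ levelSet θ) :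
    PairCert (⟨_, h⟩ : levelSet θ) := by
  intro x y z hxyz
  obtain ⟨a, b, ha, hb, ex, ey, ez⟩ := mem_pairGraph.1 hxyz
  rw [ex, ey, ez]
  refine ⟨⟨ZFSet.isOrdinal_toZFSet _, ZFSet.isOrdinal_toZFSet _, ZFSet.isOrdinal_toZFSet _⟩,
    fun e he => ?_, fun x' y' hx' hy' hk => ?_⟩
  · obtain ⟨o, ho, rfl⟩ := Ordinal.mem_toZFSet_iff.1 he
    obtain ⟨⟨a', b'⟩, hq, hle⟩ := lt_pairIdx_iff.1 ho
    have hm := (max_le_of_pairKey_lt hq).trans_lt (max_lt ha hb)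
    have hg := mem_pairGraph.2 ⟨a', b', (le_max_left _ _).trans_lt hm,
      (le_max_right _ _).trans_lt hm, rfl, rfl, rfl⟩
    obtain ⟨h1, h2, h3⟩ := triple_mem_lev h hg
    refine ⟨⟨_, h1⟩, ⟨_, h2⟩, ⟨_, h3⟩, hg, keyLT_iff.2 hq, ?_⟩
    simp only [Ordinal.toZFSet_mem_toZFSet_iff, Ordinal.toZFSet_injective.eq_iff]
    exact hle.eq_or_lt
  · obtain ⟨a', ea⟩ := exists_toZFSet hx'
    obtain ⟨b', eb⟩ := exists_toZFSet hy'
    rw [← ea, ← eb] at hk ⊢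
    have hq := keyLT_iff.1 hk
    have hm := (max_le_of_pairKey_lt hq).trans_lt (max_lt ha hb)
    have hg := mem_pairGraph.2 ⟨a', b', (le_max_left _ _).trans_lt hm,
      (le_max_right _ _).trans_lt hm, rfl, rfl, rfl⟩
    exact ⟨⟨_, (triple_mem_lev h hg).2.2⟩,
      Ordinal.toZFSet_mem_toZFSet_iff.2 (pairIdx_lt hq), hg⟩

/-! ### Ordinal codes for sets -/

/-- The positive natural number naming the operation `k` in codes; `0` is reserved for codes of
ordinals. -/
noncomputable def Op.num (k : Op) : Ordinal.{u} := ((k.idx + 1 : ℕ) : Ordinal.{u})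

theorem Op.num_pos (k : Op) : 0 < k.num := by
  rw [Op.num]; exact_mod_cast Nat.succ_pos _

theorem Op.num_injective : Function.Injective Op.num.{u} := by
  intro k l h
  simp only [Op.num, Nat.cast_inj, Nat.add_right_cancel_iff] at h
  exact Op.idx_injective (Fin.ext h)

/-- `Val c x`: the ordinal `c` codes the set `x`. -/
inductive Val : Ordinal.{u} → ZFSet.{u} → Prop
  | ord (o : Ordinal.{u}) : Val (pairIdx (0, o)) o.toZFSet
  | app (k : Op) {a b : Ordinal.{u}} {x y : ZFSet.{u}} :
    Val a x → Val b y → Val (pairIdx (k.num, pairIdx (a, b))) (k.app x y)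

theorem Val.unique {c : Ordinal.{u}} {x y : ZFSet.{u}} (hx : Val c x) (hy : Val c y) : x = y := by
  induction hx generalizing y with
  | ord o =>
    generalize e : pairIdx (0, o) = c at hy
    cases hy with
    | ord o' =>
      have := pairIdx_injective e
      simp_all
    | app k h1 h2 =>
      have := pairIdx_injective e
      simp only [Prod.mk.injEq] at this
      exact absurd this.1 k.num_pos.ne
  | app k h1 h2 ih1 ih2 =>
    generalize e : pairIdx _ = c at hy
    cases hy with
    | ord o' =>
      have := pairIdx_injective e
      simp only [Prod.mk.injEq] at this
      exact absurd this.1 k.num_pos.ne'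
    | app k' h1' h2' =>
      have := pairIdx_injective e
      simp only [Prod.mk.injEq] at this
      obtain ⟨e1, e2⟩ := this
      have e3 := pairIdx_injective e2
      simp only [Prod.mk.injEq] at e3
      obtain ⟨rfl, rfl⟩ := e3
      rw [Op.num_injective e1, ih1 h1', ih2 h2']

/-- `W` is a set of pairs `(c, z)`, each justified by pairs in `W` with smaller first component. -/
def ValCert (W g : levelSet θ) : Prop :=
  ∀ c z : levelSet θ, ZFSet.pair c.1 z.1 ∈ W.1 →
    c.1.IsOrdinal ∧
    ((z.1.IsOrdinal ∧ ∃ n : levelSet θ, n.1 = (0 : Ordinal.{u}).toZFSet ∧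
      ZFSet.pair (ZFSet.pair n.1 z.1) c.1 ∈ g.1) ∨
    ∃ (k : Op) (a b x y d n : levelSet θ), a.1 ∈ c.1 ∧ b.1 ∈ c.1 ∧ d.1 ∈ c.1 ∧
      ZFSet.pair a.1 x.1 ∈ W.1 ∧ ZFSet.pair b.1 y.1 ∈ W.1 ∧ n.1 = k.num.toZFSet ∧
      ZFSet.pair (ZFSet.pair a.1 b.1) d.1 ∈ g.1 ∧ ZFSet.pair (ZFSet.pair n.1 d.1) c.1 ∈ g.1 ∧
      z.1 = k.app x.1 y.1)

instance ValCert.dfn [Fact (Order.IsSuccLimit θ)] (i j : α) :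
    Dfn fun v : α → levelSet θ => ValCert (v i) (v j) := by
  unfold ValCert; infer_instance

/-- `V_θ` sees that the ordinal `c` codes `z`. -/
def ValIn (c z : levelSet θ) : Prop :=
  ∃ W g : levelSet θ, PairCert g ∧ ValCert W g ∧ ZFSet.pair c.1 z.1 ∈ W.1

instance ValIn.dfn [Fact (Order.IsSuccLimit θ)] (i j : α) :
    Dfn fun v : α → levelSet θ => ValIn (v i) (v j) := by
  unfold ValIn; infer_instance

/-- What `V_θ` sees to be a code is a code, by induction on the code. -/
theorem ValIn.sound {c z : levelSet θ} (h : ValIn c z) :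
    ∃ o : Ordinal.{u}, c.1 = o.toZFSet ∧ Val o z.1 := by
  obtain ⟨W, g, hg, hW, h⟩ := h
  obtain ⟨o, ho⟩ := exists_toZFSet (hW c z h).1
  refine ⟨o, ho.symm, ?_⟩
  induction o using WellFoundedLT.induction generalizing c z with
  | ind o ih =>
    obtain ⟨-, ⟨hz, n, hn, h1⟩ | ⟨k, a, b, x, y, d, n, ha, hb, hd, h1, h2, hn, h3, h4, hz⟩⟩ := hW c z h
    · obtain ⟨p, hp⟩ := exists_toZFSet hz
      rw [hn, ← hp, ← ho] at h1
      rw [← hp, hg.eq_pairIdx (0, p) _ h1]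
      exact Val.ord p
    · rw [← ho] at ha hb hd
      obtain ⟨a', ha', ea⟩ := Ordinal.mem_toZFSet_iff.1 ha
      obtain ⟨b', hb', eb⟩ := Ordinal.mem_toZFSet_iff.1 hb
      obtain ⟨d', hd', ed⟩ := Ordinal.mem_toZFSet_iff.1 hd
      rw [← ea, ← eb, ← ed] at h3
      rw [hn, ← ed, ← ho] at h4
      have e1 := hg.eq_pairIdx (a', b') _ h3
      have e2 := hg.eq_pairIdx (k.num, d') _ h4
      rw [hz, e2, e1]
      exact Val.app k (ih a' ha' h1 ea) (ih b' hb' h2 eb)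

theorem ValCert.union {W W' g : levelSet θ} (h : ValCert W g) (h' : ValCert W' g)
    (hu : W.1 ∪ W'.1 ∈ levelSet θ) : ValCert ⟨_, hu⟩ g := by
  intro c z hcz
  obtain hcz | hcz := ZFSet.mem_union.1 hcz
  · obtain ⟨h1, h2 | ⟨k, a, b, x, y, d, n, ha, hb, hd, h3, h4, h5⟩⟩ := h c z hcz
    · exact ⟨h1, Or.inl h2⟩
    · exact ⟨h1, Or.inr ⟨k, a, b, x, y, d, n, ha, hb, hd, ZFSet.mem_union.2 (Or.inl h3),
        ZFSet.mem_union.2 (Or.inl h4), h5⟩⟩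
  · obtain ⟨h1, h2 | ⟨k, a, b, x, y, d, n, ha, hb, hd, h3, h4, h5⟩⟩ := h' c z hcz
    · exact ⟨h1, Or.inl h2⟩
    · exact ⟨h1, Or.inr ⟨k, a, b, x, y, d, n, ha, hb, hd, ZFSet.mem_union.2 (Or.inr h3),
        ZFSet.mem_union.2 (Or.inr h4), h5⟩⟩

/-- A code has one certificate that works in all levels containing it and a large enough part of
the graph of the pairing function. -/
theorem Val.exists_certificate {c : Ordinal.{u}} {x : ZFSet.{u}} (h : Val c x) :
    ∃ (W : ZFSet.{u}) (μ : Ordinal.{u}), ZFSet.pair c.toZFSet x ∈ W ∧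
      ∀ (θ : Ordinal.{u}) (hW : W ∈ levelSet θ) (ν : Ordinal.{u}) (hν : pairGraph ν ∈ levelSet θ),
        μ ≤ ν → ValCert (⟨W, hW⟩ : levelSet θ) ⟨_, hν⟩ := by
  induction h with
  | ord o =>
    refine ⟨{ZFSet.pair (pairIdx (0, o)).toZFSet o.toZFSet}, o + 1, by simp,
      fun θ hW ν hν hμ c z hcz => ?_⟩
    obtain ⟨e1, e2⟩ := ZFSet.pair_injective (ZFSet.mem_singleton.1 hcz)
    rw [e1, e2]
    have hg := mem_pairGraph.2 ⟨0, o, (zero_le.trans_lt (Order.lt_add_one_iff.2 le_rfl)).trans_le hμ,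
      (Order.lt_add_one_iff.2 le_rfl).trans_le hμ, rfl, rfl, rfl⟩
    exact ⟨ZFSet.isOrdinal_toZFSet _, Or.inl ⟨ZFSet.isOrdinal_toZFSet _,
      ⟨_, (triple_mem_lev hν hg).1⟩, rfl, hg⟩⟩
  | @app k a b x y ha hb iha ihb =>
    obtain ⟨W, μ, hW, h1⟩ := iha
    obtain ⟨W', μ', hW', h2⟩ := ihb
    set d := pairIdx (a, b) with hd
    set c := pairIdx (k.num, d) with hc
    have hdc : d < c := lt_pairIdx_of_pos k.num_pos d
    have hac : a < c := (le_pairIdx_left a b).trans_lt hdc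
    have hbc : b < c := (le_pairIdx_right a b).trans_lt hdc
    refine ⟨insert (ZFSet.pair c.toZFSet (k.app x y)) (W ∪ W'),
      max (max μ μ') (max c k.num + 1), by simp, fun θ hT ν hν hμ => ?_⟩
    have hWT : W ∪ W' ⊆ insert (ZFSet.pair c.toZFSet (k.app x y)) (W ∪ W') :=
      fun z hz => ZFSet.mem_insert_of_mem _ hz
    have hr : (W ∪ W').rank < θ := (ZFSet.rank_mono hWT).trans_lt (mem_lev.1 hT)
    have hWW : W ∪ W' ∈ levelSet θ := mem_lev.2 hr
    rw [ZFSet.rank_union] at hr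
    have hWl : W ∈ levelSet θ := mem_lev.2 ((le_max_left _ _).trans_lt hr)
    have hWl' : W' ∈ levelSet θ := mem_lev.2 ((le_max_right _ _).trans_lt hr)
    have hu := (h1 θ hWl ν hν (((le_max_left _ _).trans (le_max_left _ _)).trans hμ)).union
      (h2 θ hWl' ν hν (((le_max_right _ _).trans (le_max_left _ _)).trans hμ)) hWW
    have hcν : max c k.num < ν :=
      (Order.lt_add_one_iff.2 le_rfl).trans_le ((le_max_right _ _).trans hμ)
    have hcν' := (le_max_left _ _).trans_lt hcν
    have hkν := (le_max_right _ _).trans_lt hcν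
    have g1 := mem_pairGraph.2 ⟨a, b, hac.trans hcν', hbc.trans hcν', rfl, rfl, rfl⟩
    have g2 := mem_pairGraph.2 ⟨k.num, d, hkν, hdc.trans hcν', rfl, rfl, rfl⟩
    have l1 := triple_mem_lev hν g1
    have l2 := triple_mem_lev hν g2
    intro c' z hcz
    obtain e | hcz := ZFSet.mem_insert_iff.1 hcz
    · obtain ⟨e1, e2⟩ := ZFSet.pair_injective e
      rw [e1, e2]
      refine ⟨ZFSet.isOrdinal_toZFSet _, Or.inr ⟨k, ⟨_, l1.1⟩, ⟨_, l1.2.1⟩,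
        ⟨x, (pair_mem_lev hWl hW).2⟩, ⟨y, (pair_mem_lev hWl' hW').2⟩, ⟨_, l1.2.2⟩, ⟨_, l2.1⟩,
        Ordinal.toZFSet_mem_toZFSet_iff.2 hac, Ordinal.toZFSet_mem_toZFSet_iff.2 hbc,
        Ordinal.toZFSet_mem_toZFSet_iff.2 hdc, ?_, ?_, rfl, g1, g2, rfl⟩⟩
      · exact hWT (ZFSet.mem_union.2 (Or.inl hW))
      · exact hWT (ZFSet.mem_union.2 (Or.inr hW'))
    · obtain ⟨h1, h2 | ⟨k, a, b, x, y, d, n, ha, hb, hd, h3, h4, h5⟩⟩ := hu c' z hcz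
      · exact ⟨h1, Or.inl h2⟩
      · exact ⟨h1, Or.inr ⟨k, a, b, x, y, d, n, ha, hb, hd, hWT h3, hWT h4, h5⟩⟩

/-- Codes are recognized by all sufficiently large levels. -/
theorem Val.complete {c : Ordinal.{u}} {x : ZFSet.{u}} (h : Val c x) :
    ∃ b : Ordinal.{u}, ∀ θ, b < θ → ∃ (hc : c.toZFSet ∈ levelSet θ) (hx : x ∈ levelSet θ),
      ValIn (θ := θ) ⟨_, hc⟩ ⟨_, hx⟩ := by
  obtain ⟨W, μ, hW, h⟩ := h.exists_certificate
  refine ⟨max W.rank (pairGraph μ).rank, fun θ hθ => ?_⟩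
  have hWl : W ∈ levelSet θ := mem_lev.2 ((le_max_left _ _).trans_lt hθ)
  have hg : pairGraph μ ∈ levelSet θ := mem_lev.2 ((le_max_right _ _).trans_lt hθ)
  exact ⟨(pair_mem_lev hWl hW).1, (pair_mem_lev hWl hW).2, ⟨W, hWl⟩, ⟨_, hg⟩,
    pairCert_pairGraph hg, h θ hWl μ hg le_rfl, hW⟩

/-! ### Ordinal definable sets are the sets with an ordinal code -/

section Codes

open FirstOrder FirstOrder.Language

theorem exists_limit_gt (b : Ordinal.{u}) : ∃ θ : Ordinal.{u}, b < θ ∧ Order.IsSuccLimit θ :=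
  ⟨b + Ordinal.omega0, lt_add_of_pos_right _ Ordinal.omega0_pos,
    Ordinal.isSuccLimit_add _ Ordinal.isSuccLimit_omega0⟩

/-- `x` is definable from ordinals over every sufficiently large limit level. Unlike `IsOD`, which
mentions one level, this is convenient for combining definitions. -/
def EvDfn (x : ZFSet.{u}) : Prop :=
  ∃ b : Ordinal.{u}, ∀ θ, Order.IsSuccLimit θ → b < θ → ∀ (α : Type) (i : α),
    Dfn fun v : α → levelSet θ => (v i).1 = x

theorem EvDfn.isOD {x : ZFSet.{u}} (h : EvDfn x) : IsOD x := by
  obtain ⟨b, hb⟩ := h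
  obtain ⟨θ, hθ, hl⟩ := exists_limit_gt (max b x.rank)
  have hx : x ∈ levelSet θ := mem_lev.2 ((le_max_right _ _).trans_lt hθ)
  refine ⟨θ, hx, ?_⟩
  have := (hb θ hl ((le_max_left _ _).trans_lt hθ) (Fin 1) 0).congr
    (Q := fun v => v 0 ∈ ({⟨x, hx⟩} : Set (levelSet θ))) fun v => by simp [Subtype.ext_iff]
  exact this.out

theorem Val.evDfn {c : Ordinal.{u}} {x : ZFSet.{u}} (h : Val c x) : EvDfn x := by
  induction h with
  | ord o => exact ⟨0, fun θ _ _ α i => inferInstance⟩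
  | @app k a b x y _ _ ihx ihy =>
    obtain ⟨bx, hx⟩ := ihx
    obtain ⟨by', hy⟩ := ihy
    refine ⟨max (max bx x.rank) (max by' y.rank), fun θ hl hθ α i => ?_⟩
    have : Fact (Order.IsSuccLimit θ) := ⟨hl⟩
    obtain ⟨h1, h2⟩ := max_lt_iff.1 hθ
    have hx' := hx θ hl ((le_max_left _ _).trans_lt h1)
    have hy' := hy θ hl ((le_max_left _ _).trans_lt h2)
    refine (inferInstance : Dfn fun v : α → levelSet θ => ∃ p q : levelSet θ, p.1 = x ∧ q.1 = y ∧
      (v i).1 = k.app p.1 q.1).congr fun v => ?_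
    constructor
    · intro h
      exact ⟨⟨x, mem_lev.2 ((le_max_right _ _).trans_lt h1)⟩,
        ⟨y, mem_lev.2 ((le_max_right _ _).trans_lt h2)⟩, rfl, rfl, h⟩
    · rintro ⟨p, q, hp, hq, h⟩
      rw [h, hp, hq]

/-- `x` has a code. -/
def HasVal (x : ZFSet.{u}) : Prop := ∃ c, Val c x

theorem HasVal.app {x y : ZFSet.{u}} (k : Op) (hx : HasVal x) (hy : HasVal y) :
    HasVal (k.app x y) := by
  obtain ⟨c, hc⟩ := hx
  obtain ⟨d, hd⟩ := hy
  exact ⟨_, hc.app k hd⟩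

theorem hasVal_ord (o : Ordinal.{u}) : HasVal o.toZFSet := ⟨_, Val.ord o⟩

theorem hasVal_empty : HasVal (∅ : ZFSet.{u}) := by simpa using hasVal_ord 0

theorem hasVal_vonNeumann (o : Ordinal.{u}) : HasVal (ZFSet.vonNeumann o) := by
  have : ZFSet.vonNeumann o = Op.level.app o.toZFSet ∅ := by
    ext w; simp [Op.Mem, ZFSet.mem_vonNeumann]
  rw [this]
  exact (hasVal_ord o).app _ hasVal_empty

theorem HasVal.singleton {x : ZFSet.{u}} (hx : HasVal x) : HasVal ({x} : ZFSet.{u}) := by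
  have : ({x} : ZFSet) = Op.upair.app x x := by ext w; simp [Op.Mem]
  rw [this]
  exact hx.app _ hx

/-- An assignment of the free variable and of the bound variables, as a nested pair. The newest
bound variable is outermost, so that a quantifier removes the first component. -/
def env {a : Ordinal.{u}} (y : levelSet a) : {n : ℕ} → (Fin n → levelSet a) → ZFSet.{u}
  | 0, _ => ZFSet.pair y.1 ∅
  | n + 1, xs => ZFSet.pair (xs (Fin.last n)).1 (env y fun i => xs i.castSucc)

theorem env_injective {a : Ordinal.{u}} {y y' : levelSet a} : ∀ {n : ℕ} {xs xs' : Fin n → levelSet a},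
    env y xs = env y' xs' → y = y' ∧ xs = xs'
  | 0, xs, xs', h => ⟨Subtype.ext (ZFSet.pair_injective h).1, Subsingleton.elim _ _⟩
  | n + 1, xs, xs', h => by
    obtain ⟨h1, h2⟩ := ZFSet.pair_injective h
    obtain ⟨h3, h4⟩ := env_injective h2
    refine ⟨h3, funext fun i => ?_⟩
    induction i using Fin.lastCases with
    | last => exact Subtype.ext h1
    | cast i => exact congrFun h4 i

/-- The set of all assignments in `V_a` with `n` bound variables. -/
noncomputable def envSet (a : Ordinal.{u}) : ℕ → ZFSet.{u}
  | 0 => Op.prod.app (ZFSet.vonNeumann a) {∅}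
  | n + 1 => Op.prod.app (ZFSet.vonNeumann a) (envSet a n)

theorem hasVal_envSet (a : Ordinal.{u}) : ∀ n, HasVal (envSet a n)
  | 0 => (hasVal_vonNeumann a).app _ hasVal_empty.singleton
  | n + 1 => (hasVal_vonNeumann a).app _ (hasVal_envSet a n)

theorem env_snoc {a : Ordinal.{u}} (y : levelSet a) {n : ℕ} (xs : Fin n → levelSet a) (b : levelSet a) :
    env y (Fin.snoc xs b : Fin (n + 1) → levelSet a) = ZFSet.pair b.1 (env y xs) := by
  simp [env]

theorem mem_envSet {a : Ordinal.{u}} : ∀ {n : ℕ} {e : ZFSet.{u}},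
    e ∈ envSet a n ↔ ∃ (y : levelSet a) (xs : Fin n → levelSet a), e = env y xs
  | 0, e => by
    simp only [envSet, Op.mem_app, Op.Mem, ZFSet.mem_singleton, exists_eq_left]
    exact ⟨fun ⟨y, hy, h⟩ => ⟨⟨y, hy⟩, Fin.elim0, h⟩, fun ⟨y, _, h⟩ => ⟨y.1, y.2, h⟩⟩
  | n + 1, e => by
    simp only [envSet, Op.mem_app, Op.Mem, mem_envSet (n := n)]
    constructor
    · rintro ⟨b, hb, e', ⟨y, xs, rfl⟩, rfl⟩
      exact ⟨y, Fin.snoc xs ⟨b, hb⟩, (env_snoc y xs ⟨b, hb⟩).symm⟩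
    · rintro ⟨y, xs, rfl⟩
      exact ⟨_, (xs (Fin.last n)).2, _, ⟨y, _, rfl⟩, rfl⟩

/-- The evaluation of a variable, as a set of pairs of an assignment and a value, has a code. -/
theorem hasVal_graph_free (a : Ordinal.{u}) : ∀ n : ℕ, ∃ T, HasVal T ∧ ∀ e b, ZFSet.pair e b ∈ T ↔
    ∃ (y : levelSet a) (xs : Fin n → levelSet a), e = env y xs ∧ b = y.1
  | 0 => by
    refine ⟨_, (hasVal_vonNeumann a).app .proj hasVal_empty.singleton, fun e b => ?_⟩
    simp only [Op.mem_app, Op.Mem, ZFSet.mem_singleton, exists_eq_left, ZFSet.pair_inj]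
    constructor
    · rintro ⟨y, hy, rfl, rfl⟩
      exact ⟨⟨b, hy⟩, Fin.elim0, rfl, rfl⟩
    · rintro ⟨y, xs, rfl, rfl⟩
      exact ⟨_, y.2, rfl, rfl⟩
  | n + 1 => by
    obtain ⟨T, hT, h⟩ := hasVal_graph_free a n
    refine ⟨_, (hasVal_vonNeumann a).app .lift hT, fun e b => ?_⟩
    simp only [Op.mem_app, Op.Mem, h, ZFSet.pair_inj]
    constructor
    · rintro ⟨c, hc, _, _, ⟨y, xs, rfl, rfl⟩, rfl, rfl⟩
      exact ⟨y, Fin.snoc xs ⟨c, hc⟩, (env_snoc y xs ⟨c, hc⟩).symm, rfl⟩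
    · rintro ⟨y, xs, rfl, rfl⟩
      exact ⟨_, (xs (Fin.last n)).2, _, _, ⟨y, _, rfl, rfl⟩, rfl, rfl⟩

theorem hasVal_graph_bound (a : Ordinal.{u}) : ∀ {n : ℕ} (i : Fin n), ∃ T, HasVal T ∧
    ∀ e b, ZFSet.pair e b ∈ T ↔
      ∃ (y : levelSet a) (xs : Fin n → levelSet a), e = env y xs ∧ b = (xs i).1
  | 0, i => i.elim0
  | n + 1, i => by
    induction i using Fin.lastCases with
    | last =>
      refine ⟨_, (hasVal_vonNeumann a).app .proj (hasVal_envSet a n), fun e b => ?_⟩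
      simp only [Op.mem_app, Op.Mem, mem_envSet, ZFSet.pair_inj]
      constructor
      · rintro ⟨c, hc, _, ⟨y, xs, rfl⟩, rfl, rfl⟩
        exact ⟨y, Fin.snoc xs ⟨b, hc⟩, (env_snoc y xs ⟨b, hc⟩).symm, by simp⟩
      · rintro ⟨y, xs, rfl, rfl⟩
        exact ⟨_, (xs (Fin.last n)).2, _, ⟨y, _, rfl⟩, rfl, rfl⟩
    | cast i =>
      obtain ⟨T, hT, h⟩ := hasVal_graph_bound a i
      refine ⟨_, (hasVal_vonNeumann a).app .lift hT, fun e b => ?_⟩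
      simp only [Op.mem_app, Op.Mem, h, ZFSet.pair_inj]
      constructor
      · rintro ⟨c, hc, _, _, ⟨y, xs, rfl, rfl⟩, rfl, rfl⟩
        exact ⟨y, Fin.snoc xs ⟨c, hc⟩, (env_snoc y xs ⟨c, hc⟩).symm, by simp⟩
      · rintro ⟨y, xs, rfl, rfl⟩
        exact ⟨_, (xs (Fin.last n)).2, _, _, ⟨y, _, rfl, rfl⟩, rfl, rfl⟩

/-- The ordinal parameters available in the level `V_a`. -/
abbrev OrdParam (a : Ordinal.{u}) : Set (levelSet a) := {p | (p : ZFSet.{u}).IsOrdinal}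

/-- The language has no function symbols, so a term is a parameter or a variable. -/
theorem hasVal_graph_term {a : Ordinal.{u}} {n : ℕ}
    (t : setLang.Term ((OrdParam a ⊕ Fin 1) ⊕ Fin n)) : ∃ T, HasVal T ∧ ∀ e b, ZFSet.pair e b ∈ T ↔
    ∃ (y : levelSet a) (xs : Fin n → levelSet a), e = env y xs ∧
      b = (t.realize (Sum.elim (Sum.elim (↑) fun _ => y) xs) : levelSet a).1 := by
  cases t with
  | func f _ => exact f.elim
  | var i =>
    obtain (⟨p, hp⟩ | i) | i := i
    · obtain ⟨o, ho⟩ := exists_toZFSet hp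
      refine ⟨_, (hasVal_envSet a n).app .prod (hasVal_ord o).singleton, fun e b => ?_⟩
      simp only [Op.mem_app, Op.Mem, mem_envSet, ZFSet.mem_singleton, ZFSet.pair_inj]
      constructor
      · rintro ⟨_, ⟨y, xs, rfl⟩, _, rfl, rfl, rfl⟩
        exact ⟨y, xs, rfl, by simp [ho]⟩
      · rintro ⟨y, xs, rfl, rfl⟩
        exact ⟨_, ⟨y, xs, rfl⟩, _, rfl, rfl, by simp [ho]⟩
    · simpa using hasVal_graph_free a n
    · simpa using hasVal_graph_bound a i

/-- The set of assignments satisfying a formula over `V_a` has a code, by induction on the formula.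
This replaces the definability of the satisfaction relation. -/
theorem hasVal_realize {a : Ordinal.{u}} {n : ℕ} (φ : setLang.BoundedFormula (OrdParam a ⊕ Fin 1) n) :
    ∃ R, HasVal R ∧ ∀ e, e ∈ R ↔ ∃ (y : levelSet a) (xs : Fin n → levelSet a), e = env y xs ∧
      φ.Realize (Sum.elim (↑) fun _ => y) xs := by
  induction φ with
  | falsum =>
    refine ⟨_, hasVal_empty, fun e => ?_⟩
    simp [BoundedFormula.Realize]
  | equal t s =>
    obtain ⟨T, hT, h1⟩ := hasVal_graph_term t
    obtain ⟨S, hS, h2⟩ := hasVal_graph_term s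
    refine ⟨_, hT.app .eqRel hS, fun e => ?_⟩
    simp only [Op.mem_app, Op.Mem, h1, h2, BoundedFormula.Realize]
    constructor
    · rintro ⟨_, _, ⟨y, xs, rfl, rfl⟩, _, _, ⟨y', xs', rfl, rfl⟩, rfl, h, h'⟩
      obtain ⟨rfl, rfl⟩ := env_injective h
      exact ⟨y, xs, rfl, Subtype.ext h'⟩
    · rintro ⟨y, xs, rfl, h⟩
      exact ⟨_, _, ⟨y, xs, rfl, rfl⟩, _, _, ⟨y, xs, rfl, rfl⟩, rfl, rfl, congrArg _ h⟩
  | rel R ts =>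
    cases R with
    | mem =>
    obtain ⟨T, hT, h1⟩ := hasVal_graph_term (ts 0)
    obtain ⟨S, hS, h2⟩ := hasVal_graph_term (ts 1)
    refine ⟨_, hT.app .memRel hS, fun e => ?_⟩
    simp only [Op.mem_app, Op.Mem, h1, h2, BoundedFormula.Realize]
    constructor
    · rintro ⟨_, _, ⟨y, xs, rfl, rfl⟩, _, _, ⟨y', xs', rfl, rfl⟩, rfl, h, h'⟩
      obtain ⟨rfl, rfl⟩ := env_injective h
      exact ⟨y, xs, rfl, h'⟩
    · rintro ⟨y, xs, rfl, h⟩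
      exact ⟨_, _, ⟨y, xs, rfl, rfl⟩, _, _, ⟨y, xs, rfl, rfl⟩, rfl, rfl, h⟩
  | @imp n f g ihf ihg =>
    obtain ⟨F, hF, h1⟩ := ihf
    obtain ⟨G, hG, h2⟩ := ihg
    refine ⟨_, (hasVal_envSet a n).app .diff (hF.app .diff hG), fun e => ?_⟩
    simp only [Op.mem_app, Op.Mem, h1, h2, BoundedFormula.realize_imp, mem_envSet]
    constructor
    · rintro ⟨⟨y, xs, rfl⟩, h⟩
      refine ⟨y, xs, rfl, fun hf => ?_⟩
      by_contra hg
      refine h ⟨⟨y, xs, rfl, hf⟩, ?_⟩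
      rintro ⟨y', xs', e, h'⟩
      obtain ⟨rfl, rfl⟩ := env_injective e
      exact hg h'
    · rintro ⟨y, xs, rfl, h⟩
      refine ⟨⟨y, xs, rfl⟩, ?_⟩
      rintro ⟨⟨y', xs', e, h'⟩, h2⟩
      obtain ⟨rfl, rfl⟩ := env_injective e
      exact h2 ⟨_, _, rfl, h h'⟩
  | @all n f ih =>
    obtain ⟨F, hF, h1⟩ := ih
    refine ⟨_, (hasVal_envSet a n).app .diff
      (((hasVal_envSet a (n + 1)).app .diff hF).app .ran hasVal_empty), fun e => ?_⟩
    simp only [Op.mem_app, Op.Mem, h1, BoundedFormula.realize_all, mem_envSet]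
    constructor
    · rintro ⟨⟨y, xs, rfl⟩, h⟩
      refine ⟨y, xs, rfl, fun b => ?_⟩
      by_contra hb
      refine h ⟨b.1, _, ⟨⟨y, Fin.snoc xs b, (env_snoc y xs b).symm⟩, ?_⟩, rfl⟩
      rintro ⟨y', xs', e, h'⟩
      rw [← env_snoc] at e
      obtain ⟨rfl, rfl⟩ := env_injective e
      exact hb h'
    · rintro ⟨y, xs, rfl, h⟩
      refine ⟨⟨y, xs, rfl⟩, ?_⟩
      rintro ⟨b, _, ⟨⟨y', xs', e⟩, h'⟩, rfl⟩
      have hb : b = (xs' (Fin.last n)).1 := (ZFSet.pair_injective e).1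
      rw [hb, ← env_snoc] at h'
      exact h' ⟨y, _, rfl, h _⟩

theorem hasVal_of_isOD {x : ZFSet.{u}} (h : IsOD x) : HasVal x := by
  obtain ⟨a, hx, h⟩ := h
  obtain ⟨φ, hφ⟩ := Set.definable_iff_exists_formula_sum.1 h
  obtain ⟨R, hR, h1⟩ := hasVal_realize φ
  have key : ∀ e, e ∈ R ↔ e = ZFSet.pair x ∅ := by
    intro e
    rw [h1]
    have h2 : ∀ y : levelSet a, y.1 = x ↔ φ.Realize (Sum.elim (↑) fun _ => y) := by
      intro y
      have := Set.ext_iff.1 hφ fun _ => y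
      simpa [Subtype.ext_iff] using this
    constructor
    · rintro ⟨y, xs, rfl, h3⟩
      have : φ.Realize (Sum.elim (↑) fun _ => y) := by
        rw [Formula.Realize, Subsingleton.elim default xs]; exact h3
      rw [env, (h2 y).2 this]
    · rintro rfl
      exact ⟨⟨x, hx⟩, default, rfl, (h2 ⟨x, hx⟩).1 rfl⟩
  -- a singleton whose element is the pair of `x` and the empty set determines `x` by three unions
  have hxe : x = Op.union.app (Op.union.app (Op.union.app R ∅) ∅) ∅ := by
    ext w
    simp [Op.Mem, key, ZFSet.pair]
  rw [hxe]
  exact ((hR.app _ hasVal_empty).app _ hasVal_empty).app _ hasVal_empty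

theorem isOD_iff_hasVal {x : ZFSet.{u}} : IsOD x ↔ ∃ c, Val c x :=
  ⟨hasVal_of_isOD, fun ⟨_, h⟩ => h.evDfn.isOD⟩

theorem isOD_iff_evDfn {x : ZFSet.{u}} : IsOD x ↔ EvDfn x :=
  ⟨fun h => let ⟨_, hc⟩ := isOD_iff_hasVal.1 h; hc.evDfn, EvDfn.isOD⟩

end Codes

/-! ### Proving ordinal definability -/

instance Dfn.exTuple [Finite β] {Q : (α → levelSet θ) → (β → levelSet θ) → Prop}
    [h : Dfn fun w : α ⊕ β → levelSet θ => Q (fun a => w (Sum.inl a)) (fun b => w (Sum.inr b))] :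
    Dfn fun v => ∃ p : β → levelSet θ, Q v p :=
  Dfn.congr ⟨h.out.exists_of_finite⟩ fun _ => Iff.rfl

instance Dfn.finiteAll {ι : Type} [Finite ι] {Q : ι → (α → levelSet θ) → Prop}
    [h : ∀ k, Dfn (Q k)] : Dfn fun v => ∀ k, Q k v :=
  (inferInstance : Dfn fun v => ¬ ∃ k, ¬ Q k v).congr fun v => by simp

/-- A set is ordinal definable if its elements are uniformly definable from ordinal definable
parameters over all sufficiently large limit levels. -/
theorem isOD_of_dfn {n : ℕ} (x : Fin n → ZFSet.{u}) (hx : ∀ i, IsOD (x i)) {Z : ZFSet.{u}}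
    (b : Ordinal.{u})
    (h : ∀ θ : Ordinal.{u}, [Fact (Order.IsSuccLimit θ)] → b < θ →
      ∃ φ : (Option (Fin n) → levelSet θ) → Prop, Dfn φ ∧
        ∀ v, (∀ i, (v (some i)).1 = x i) → ((v none).1 ∈ Z ↔ φ v)) : IsOD Z := by
  choose c hc using fun i => isOD_iff_evDfn.1 (hx i)
  refine EvDfn.isOD ⟨max (max b Z.rank) (Finset.univ.sup fun i => max (c i) (x i).rank),
    fun θ hl hθ α j => ?_⟩
  have : Fact (Order.IsSuccLimit θ) := ⟨hl⟩
  obtain ⟨h1, h2⟩ := max_lt_iff.1 hθ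
  obtain ⟨hb, hZ⟩ := max_lt_iff.1 h1
  have h3 : ∀ i, max (c i) (x i).rank < θ := fun i =>
    (Finset.le_sup (f := fun i => max (c i) (x i).rank) (Finset.mem_univ i)).trans_lt h2
  have hxd : ∀ i (γ : Type) (k : γ), Dfn fun v : γ → levelSet θ => (v k).1 = x i := fun i =>
    hc i θ hl ((le_max_left _ _).trans_lt (h3 i))
  obtain ⟨φ, hφ, hφZ⟩ := h θ hb
  have hcomp : Dfn fun w : Option (α ⊕ Fin n) → levelSet θ =>
      φ fun o => w (o.elim none fun i => some (Sum.inr i)) := hφ.comp _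
  have hd : Dfn fun v : α → levelSet θ => ∃ p : Fin n → levelSet θ, (∀ i, (p i).1 = x i) ∧
      ∀ w : levelSet θ, w.1 ∈ (v j).1 ↔ φ fun o => o.elim w p := by
    have : Dfn fun w : Option (α ⊕ Fin n) → levelSet θ =>
      φ fun o => o.elim (w none) fun i => w (some (Sum.inr i)) := hcomp.congr fun w => by
        have : (fun o : Option (Fin n) => o.elim (w none) fun i => w (some (Sum.inr i))) =
          fun o => w (o.elim none fun i => some (Sum.inr i)) := by funext o; cases o <;> rfl
        rw [this]
    infer_instance
  refine hd.congr fun v => ?_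
  constructor
  · intro e
    refine ⟨fun i => ⟨x i, mem_lev.2 ((le_max_right _ _).trans_lt (h3 i))⟩, fun _ => rfl, fun w => ?_⟩
    rw [e]
    exact hφZ (fun o => o.elim w fun i => ⟨x i, _⟩) fun _ => rfl
  · rintro ⟨p, hp, hw⟩
    ext w
    constructor
    · intro h
      have hwl := mem_lev_of_mem (v j).2 h
      exact (hφZ (fun o => o.elim ⟨w, hwl⟩ p) hp).2 ((hw ⟨w, hwl⟩).1 h)
    · intro h
      have hwl : w ∈ levelSet θ := mem_lev.2 ((ZFSet.rank_lt_of_mem h).trans hZ)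
      exact (hw ⟨w, hwl⟩).2 ((hφZ (fun o => o.elim ⟨w, hwl⟩ p) hp).1 h)

/-- The least code of an ordinal definable set; `0` for other sets. -/
noncomputable def code (x : ZFSet.{u}) : Ordinal.{u} := sInf {c | Val c x}

theorem val_code {x : ZFSet.{u}} (h : IsOD x) : Val (code x) x :=
  csInf_mem (s := {c | Val c x}) (isOD_iff_hasVal.1 h)

/-- The least codes of all ordinal definable elements of a set are recognized by all sufficiently
large levels. -/
theorem exists_bound_valIn (P : ZFSet.{u}) : ∃ b : Ordinal.{u}, ∀ θ, b < θ →
    ∀ x ∈ P, IsOD x → ∃ (hc : (code x).toZFSet ∈ levelSet θ) (hx : x ∈ levelSet θ),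
      ValIn (θ := θ) ⟨_, hc⟩ ⟨_, hx⟩ := by
  have : ∀ x : P, ∃ b : Ordinal.{u}, ∀ θ, b < θ → IsOD x.1 →
      ∃ (hc : (code x.1).toZFSet ∈ levelSet θ) (hx : x.1 ∈ levelSet θ),
      ValIn (θ := θ) ⟨_, hc⟩ ⟨_, hx⟩ := by
    intro x
    by_cases hx : IsOD x.1
    · obtain ⟨b, hb⟩ := (val_code hx).complete
      exact ⟨b, fun θ hθ _ => hb θ hθ⟩
    · exact ⟨0, fun θ _ h => absurd h hx⟩
  choose b hb using this
  exact ⟨⨆ x, b x, fun θ hθ x hx => hb ⟨x, hx⟩ θ ((Ordinal.le_iSup b ⟨x, hx⟩).trans_lt hθ)⟩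

theorem ValIn.isOD {c x : levelSet θ} (h : ValIn c x) : IsOD x.1 :=
  let ⟨o, _, ho⟩ := h.sound
  isOD_iff_hasVal.2 ⟨o, ho⟩

/-! ### Closure properties of HOD -/

theorem mem_HOD_iff {x : ZFSet.{u}} : x ∈ HOD ↔ IsOD x ∧ ∀ y ∈ x, y ∈ HOD :=
  ZFSet.hereditarily_iff

theorem mem_HOD_of_subset {x : ZFSet.{u}} {l : Ordinal.{u}} (h : IsOD x) (hx : x ⊆ l.toZFSet) :
    x ∈ HOD := by
  refine mem_HOD_iff.2 ⟨h, fun y hy => ?_⟩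
  obtain ⟨o, -, rfl⟩ := Ordinal.mem_toZFSet_iff.1 (hx hy)
  exact toZFSet_mem_HOD o

theorem isOD_of_mem_HOD {x : ZFSet.{u}} (h : x ∈ HOD) : IsOD x := (mem_HOD_iff.1 h).1

theorem mem_HOD_of_mem {x y : ZFSet.{u}} (h : x ∈ HOD) (hy : y ∈ x) : y ∈ HOD :=
  (mem_HOD_iff.1 h).2 y hy

theorem isOD_upair {x y : ZFSet.{u}} (hx : IsOD x) (hy : IsOD y) : IsOD ({x, y} : ZFSet.{u}) :=
  isOD_of_dfn ![x, y] (Fin.forall_fin_two.2 ⟨hx, hy⟩) 0 fun θ _ _ =>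
    ⟨fun v => (v none).1 = (v (some 0)).1 ∨ (v none).1 = (v (some 1)).1, inferInstance,
      fun v h => by beta_reduce; rw [h 0, h 1]; simp⟩

theorem upair_mem_HOD {x y : ZFSet.{u}} (hx : x ∈ HOD) (hy : y ∈ HOD) : ({x, y} : ZFSet.{u}) ∈ HOD :=
  mem_HOD_iff.2 ⟨isOD_upair (isOD_of_mem_HOD hx) (isOD_of_mem_HOD hy), fun z hz => by
    obtain rfl | rfl := ZFSet.mem_pair.1 hz <;> assumption⟩

theorem pair_mem_HOD {x y : ZFSet.{u}} (hx : x ∈ HOD) (hy : y ∈ HOD) : ZFSet.pair x y ∈ HOD := by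
  have := upair_mem_HOD hx hx
  rw [ZFSet.pair_eq_singleton] at this
  exact upair_mem_HOD this (upair_mem_HOD hx hy)

theorem isOD_inter {x y : ZFSet.{u}} (hx : IsOD x) (hy : IsOD y) : IsOD (x ∩ y) :=
  isOD_of_dfn ![x, y] (Fin.forall_fin_two.2 ⟨hx, hy⟩) 0 fun θ _ _ =>
    ⟨fun v => (v none).1 ∈ (v (some 0)).1 ∧ (v none).1 ∈ (v (some 1)).1, inferInstance,
      fun v h => by beta_reduce; rw [h 0, h 1]; simp⟩

theorem isOD_sdiff {x y : ZFSet.{u}} (hx : IsOD x) (hy : IsOD y) : IsOD (x \ y) :=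
  isOD_of_dfn ![x, y] (Fin.forall_fin_two.2 ⟨hx, hy⟩) 0 fun θ _ _ =>
    ⟨fun v => (v none).1 ∈ (v (some 0)).1 ∧ ¬ (v none).1 ∈ (v (some 1)).1, inferInstance,
      fun v h => by beta_reduce; rw [h 0, h 1]; simp⟩

/-- The intersection, inside `s`, of the values of the relation `f`. -/
theorem isOD_interValues {s f : ZFSet.{u}} (hs : IsOD s) (hf : IsOD f) :
    IsOD (s.sep fun z => ∀ a X, ZFSet.pair a X ∈ f → z ∈ X) :=
  isOD_of_dfn ![s, f] (Fin.forall_fin_two.2 ⟨hs, hf⟩) 0 fun θ _ _ =>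
    ⟨fun v => (v none).1 ∈ (v (some 0)).1 ∧
      ∀ a X, ZFSet.pair a X ∈ (v (some 1)).1 → (v none).1 ∈ X, inferInstance,
      fun v h => by beta_reduce; rw [h 0, h 1]; simp⟩

/-- The ordinal definable elements of an ordinal definable set. -/
theorem isOD_sep_isOD {P : ZFSet.{u}} (hP : IsOD P) : IsOD (P.sep IsOD) := by
  obtain ⟨b, hb⟩ := exists_bound_valIn P
  refine isOD_of_dfn ![P] (by simpa) b fun θ _ hθ =>
    ⟨fun v => (v none).1 ∈ (v (some 0)).1 ∧ ∃ c : levelSet θ, ValIn c (v none), inferInstance,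
      fun v h => ?_⟩
  beta_reduce
  rw [h 0, ZFSet.mem_sep]
  refine and_congr_right fun hv => ⟨fun h => ?_, fun ⟨c, hc⟩ => hc.isOD⟩
  obtain ⟨_, _, h'⟩ := hb θ hθ _ hv h
  exact ⟨_, h'⟩

/-! ### Clubs and stationary sets -/

/-- `C` is a closed unbounded subset of the ordinal `L`, as a formula. -/
def ClubSet (L C : ZFSet.{u}) : Prop :=
  C ⊆ L ∧ (∀ a, a ∈ L → ∃ c, c ∈ C ∧ (a = c ∨ a ∈ c)) ∧
    ∀ a, a ∈ L → (∃ c, c ∈ C ∧ c ∈ a) → (∀ b, b ∈ a → ∃ c, c ∈ C ∧ (b ∈ c ∧ c ∈ a)) → a ∈ C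

instance ClubSet.dfn (i j : α) : Dfn fun v : α → levelSet θ => ClubSet (v i).1 (v j).1 := by
  unfold ClubSet; infer_instance

theorem mem_ordTrace {l : Ordinal.{u}} {S : ZFSet.{u}} {a : Set.Iio l} :
    a ∈ ordTrace l S ↔ a.1.toZFSet ∈ S := Iff.rfl

theorem clubSet_iff {l : Ordinal.{u}} {C : ZFSet.{u}} (hC : C ⊆ l.toZFSet) :
    ClubSet l.toZFSet C ↔ IsClub (ordTrace l C) := by
  have hmem : ∀ {c}, c ∈ C → ∃ (o : Ordinal.{u}) (_ : o < l), o.toZFSet = c := fun h => by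
    obtain ⟨o, ho, e⟩ := Ordinal.mem_toZFSet_iff.1 (hC h)
    exact ⟨o, ho, e⟩
  constructor
  · rintro ⟨-, h1, h2⟩
    refine ⟨fun d hd hne _ a ha => ?_, fun a => ?_⟩
    · by_cases had : a ∈ d
      · exact hd had
      refine h2 _ (Ordinal.toZFSet_mem_toZFSet_iff.2 a.2) ?_ fun b hb => ?_
      · obtain ⟨c, hc⟩ := hne
        refine ⟨_, hd hc, Ordinal.toZFSet_mem_toZFSet_iff.2 ?_⟩
        exact lt_of_le_of_ne (ha.1 hc) fun e => had (Subtype.ext e ▸ hc)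
      · obtain ⟨o, ho, rfl⟩ := Ordinal.mem_toZFSet_iff.1 hb
        obtain ⟨c, hc, hoc⟩ := (lt_isLUB_iff ha).1 (show (⟨o, ho.trans a.2⟩ : Set.Iio l) < a from ho)
        refine ⟨_, hd hc, Ordinal.toZFSet_mem_toZFSet_iff.2 hoc, Ordinal.toZFSet_mem_toZFSet_iff.2 ?_⟩
        exact lt_of_le_of_ne (ha.1 hc) fun e => had (Subtype.ext e ▸ hc)
    · obtain ⟨c, hc, h⟩ := h1 _ (Ordinal.toZFSet_mem_toZFSet_iff.2 a.2)
      obtain ⟨o, ho, rfl⟩ := hmem hc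
      rw [Ordinal.toZFSet_mem_toZFSet_iff, Ordinal.toZFSet_injective.eq_iff] at h
      exact ⟨⟨o, ho⟩, hc, h.elim le_of_eq le_of_lt⟩
  · rintro ⟨h1, h2⟩
    refine ⟨hC, fun a ha => ?_, fun a ha hne hlim => ?_⟩
    · obtain ⟨o, ho, rfl⟩ := Ordinal.mem_toZFSet_iff.1 ha
      obtain ⟨c, hc, h⟩ := h2 ⟨o, ho⟩
      refine ⟨c.1.toZFSet, hc, ?_⟩
      rw [Ordinal.toZFSet_mem_toZFSet_iff, Ordinal.toZFSet_injective.eq_iff]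
      exact eq_or_lt_of_le h
    · obtain ⟨o, ho, rfl⟩ := Ordinal.mem_toZFSet_iff.1 ha
      refine h1 (d := {c | c ∈ ordTrace l C ∧ c.1 < o}) (fun c hc => hc.1) ?_ (.of_linearOrder _)
        (a := ⟨o, ho⟩) ⟨fun c hc => hc.2.le, fun b hb => ?_⟩
      · obtain ⟨c, hc, hco⟩ := hne
        obtain ⟨p, hp, rfl⟩ := hmem hc
        exact ⟨⟨p, hp⟩, hc, Ordinal.toZFSet_mem_toZFSet_iff.1 hco⟩
      · by_contra hlt
        rw [not_le] at hlt
        obtain ⟨c, hc, hbc, hco⟩ := hlim _ (Ordinal.toZFSet_mem_toZFSet_iff.2 hlt)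
        obtain ⟨p, hp, rfl⟩ := hmem hc
        exact ((Ordinal.toZFSet_mem_toZFSet_iff.1 hbc).trans_le
          (hb (a := ⟨p, hp⟩) ⟨hc, Ordinal.toZFSet_mem_toZFSet_iff.1 hco⟩)).false

theorem isStationaryIn_iff {l : Ordinal.{u}} {X : ZFSet.{u}} :
    IsStationaryIn l X ↔ ∀ C, ClubSet l.toZFSet C → ∃ x, x ∈ C ∧ x ∈ X := by
  constructor
  · intro h C hC
    obtain ⟨a, ha, haC⟩ := h ((clubSet_iff hC.1).1 hC)
    exact ⟨a.1.toZFSet, haC, ha⟩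
  · intro h t ht
    let C : ZFSet.{u} := ZFSet.range fun a : t => a.1.1.toZFSet
    have hCl : C ⊆ l.toZFSet := by
      intro x hx
      obtain ⟨a, rfl⟩ := ZFSet.mem_range.1 hx
      exact Ordinal.toZFSet_mem_toZFSet_iff.2 a.1.2
    have htr : ordTrace l C = t := by
      ext a
      rw [mem_ordTrace, ZFSet.mem_range]
      constructor
      · rintro ⟨b, hb⟩
        rw [← Subtype.ext (Ordinal.toZFSet_injective hb)]
        exact b.2
      · intro ha; exact ⟨⟨a, ha⟩, rfl⟩
    obtain ⟨x, hxC, hxX⟩ := h C ((clubSet_iff hCl).2 (htr ▸ ht))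
    obtain ⟨a, rfl⟩ := ZFSet.mem_range.1 hxC
    exact ⟨a.1, hxX, a.2⟩

/-- The set of stationary subsets of `l`. -/
noncomputable def statSet (l : Ordinal.{u}) : ZFSet.{u} :=
  l.toZFSet.powerset.sep (IsStationaryIn l)

theorem mem_statSet {l : Ordinal.{u}} {X : ZFSet.{u}} :
    X ∈ statSet l ↔ X ⊆ l.toZFSet ∧ IsStationaryIn l X := by
  rw [statSet, ZFSet.mem_sep, ZFSet.mem_powerset]

/-- Every club of `l` lies in each level above `l`, so stationarity is decided there. -/
theorem isOD_statSet (l : Ordinal.{u}) : IsOD (statSet l) := by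
  refine isOD_of_dfn ![l.toZFSet] (by simpa using isOD_toZFSet l) l fun θ hθ hl =>
    ⟨fun v => (v none).1 ⊆ (v (some 0)).1 ∧ ∀ C : levelSet θ, ClubSet (v (some 0)).1 C.1 →
      ∃ x, x ∈ C.1 ∧ x ∈ (v none).1, inferInstance, fun v h => ?_⟩
  beta_reduce
  rw [h 0, mem_statSet, isStationaryIn_iff]
  refine and_congr_right fun _ => ⟨fun h C => h C.1, fun h C hC => h ⟨C, mem_lev.2 ?_⟩ hC⟩
  exact ((ZFSet.rank_mono hC.1).trans_eq (Ordinal.rank_toZFSet l)).trans_lt hl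

/-! ### Cofinality `ω` -/

theorem cof_eq_aleph0_iff {a : Ordinal.{u}} : a.cof = ℵ₀ ↔
    0 < a ∧ ∃ f : ℕ → Ordinal.{u}, (∀ n, f n < a) ∧ ∀ b < a, ∃ n, b < f n := by
  constructor
  · intro h
    have hlim : Order.IsSuccLimit a := by
      rw [← Ordinal.one_lt_cof_iff, h]; exact one_lt_aleph0
    refine ⟨hlim.bot_lt, ?_⟩
    obtain ⟨s, hs, hc⟩ := Order.exists_cof_eq (Set.Iio a)
    rw [Ordinal.cof_Iio, ← Ordinal.lift_cof, h, lift_aleph0] at hc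
    have : Countable s := mk_le_aleph0_iff.1 hc.le
    have : Nonempty s := mk_ne_zero_iff.1 (hc ▸ aleph0_ne_zero)
    obtain ⟨g, hg⟩ := exists_surjective_nat s
    refine ⟨fun n => (g n).1.1, fun n => (g n).1.2, fun b hb => ?_⟩
    obtain ⟨c, hc, hbc⟩ := hs ⟨Order.succ b, hlim.succ_lt hb⟩
    obtain ⟨n, hn⟩ := hg ⟨c, hc⟩
    exact ⟨n, (Order.lt_succ b).trans_le (by simp only [hn]; exact hbc)⟩
  · rintro ⟨h0, f, hf, hb⟩
    apply le_antisymm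
    · rw [← lift_le.{u + 1}, Ordinal.lift_cof, ← Ordinal.cof_Iio, lift_aleph0]
      let g : ℕ → Set.Iio a := fun n => ⟨f n, hf n⟩
      have hg : IsCofinal (Set.range g) := fun b => by
        obtain ⟨n, hn⟩ := hb b.1 b.2
        exact ⟨g n, ⟨n, rfl⟩, hn.le⟩
      exact (Order.cof_le hg).trans (mk_le_aleph0_iff.2 (Set.countable_range g).to_subtype)
    · rw [Ordinal.aleph0_le_cof_iff, Ordinal.one_lt_cof_iff, Order.isSuccLimit_iff_of_orderBot]
      refine ⟨h0.ne', Order.isSuccPrelimit_of_succ_lt fun b hb' => ?_⟩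
      obtain ⟨n, hn⟩ := hb b hb'
      exact (Order.succ_le_of_lt hn).trans_lt (hf n)

theorem mem_cofOmega {l : Ordinal.{u}} {x : ZFSet.{u}} : x ∈ cofOmega l ↔
    ∃ a : Ordinal.{u}, a < l ∧ x = a.toZFSet ∧ a.cof = ℵ₀ := by
  rw [cofOmega, ZFSet.mem_sep, Ordinal.mem_toZFSet_iff]
  constructor
  · rintro ⟨⟨b, hb, rfl⟩, a, e, h⟩
    exact ⟨a, Ordinal.toZFSet_injective e ▸ hb, e, h⟩
  · rintro ⟨a, ha, rfl, h⟩
    exact ⟨⟨a, ha, rfl⟩, a, rfl, h⟩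

theorem cofOmega_subset (l : Ordinal.{u}) : cofOmega l ⊆ l.toZFSet := ZFSet.sep_subset

/-- A cofinal sequence of type `ω` in an ordinal below `l` lies in each limit level above `l` and
`ω`, so cofinality `ω` is decided there. -/
theorem isOD_cofOmega (l : Ordinal.{u}) : IsOD (cofOmega l) := by
  -- the conjunct `y = y` gives the bounded quantifier the shape the instances ask for
  refine isOD_of_dfn ![l.toZFSet, Ordinal.omega0.toZFSet]
    (Fin.forall_fin_two.2 ⟨isOD_toZFSet l, isOD_toZFSet _⟩) (max l Ordinal.omega0) fun θ hθ hl =>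
    ⟨fun v => (v none).1 ∈ (v (some 0)).1 ∧ (∃ y, y ∈ (v none).1 ∧ y = y) ∧ ∃ f : levelSet θ,
      (∀ n c, ZFSet.pair n c ∈ f.1 → ∀ n' c', ZFSet.pair n' c' ∈ f.1 → n = n' → c = c') ∧
      ∀ b, b ∈ (v none).1 → ∃ n, n ∈ (v (some 1)).1 ∧ ∃ c, c ∈ (v none).1 ∧
        ZFSet.pair n c ∈ f.1 ∧ b ∈ c, inferInstance, fun v h => ?_⟩
  beta_reduce
  have h1 := h 1
  rw [h 0, cofOmega, ZFSet.mem_sep]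
  refine and_congr_right fun hv => ?_
  obtain ⟨a, ha, e⟩ := Ordinal.mem_toZFSet_iff.1 hv
  simp only [Matrix.cons_val_one, Matrix.cons_val_zero] at h1
  rw [← e, h1]
  have : (∃ a_1 : Ordinal, a.toZFSet = a_1.toZFSet ∧ a_1.cof = ℵ₀) ↔ a.cof = ℵ₀ :=
    ⟨fun ⟨b, hb, h⟩ => Ordinal.toZFSet_injective hb ▸ h, fun h => ⟨a, rfl, h⟩⟩
  rw [this, cof_eq_aleph0_iff]
  have h0 : (∃ y, y ∈ a.toZFSet ∧ y = y) ↔ 0 < a := by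
    refine ⟨?_, fun h0 => ⟨_, Ordinal.toZFSet_mem_toZFSet_iff.2 h0, rfl⟩⟩
    rintro ⟨y, hy, -⟩
    obtain ⟨o, ho, -⟩ := Ordinal.mem_toZFSet_iff.1 hy
    exact zero_le.trans_lt ho
  rw [h0]
  refine and_congr_right fun h0 => ?_
  constructor
  · rintro ⟨f, hf, hb⟩
    let F : ZFSet.{u} := ZFSet.range fun n : ULift.{u} ℕ =>
      ZFSet.pair (n.down : Ordinal.{u}).toZFSet (f n.down).toZFSet
    have hF : F ∈ levelSet θ := by
      refine mem_lev.2 (lt_of_le_of_lt ((ZFSet.rank_le_iff (o := max l Ordinal.omega0 + 2)).2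
        fun p hp => ?_) (by exact_mod_cast add_nat_lt hθ.1 hl 2))
      obtain ⟨n, rfl⟩ := ZFSet.mem_range.1 hp
      refine rank_pair_lt ?_ ?_
      · rw [Ordinal.rank_toZFSet]
        exact (Ordinal.natCast_lt_omega0 _).trans_le (le_max_right _ _)
      · rw [Ordinal.rank_toZFSet]
        exact ((hf _).trans ha).trans_le (le_max_left _ _)
    refine ⟨⟨F, hF⟩, fun n c h n' c' h' hn => ?_, fun b hb' => ?_⟩
    · obtain ⟨m, hm⟩ := ZFSet.mem_range.1 h
      obtain ⟨m', hm'⟩ := ZFSet.mem_range.1 h'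
      obtain ⟨rfl, rfl⟩ := ZFSet.pair_injective hm
      obtain ⟨rfl, rfl⟩ := ZFSet.pair_injective hm'
      have := Nat.cast_injective (Ordinal.toZFSet_injective hn)
      rw [this]
    · obtain ⟨o, ho, rfl⟩ := Ordinal.mem_toZFSet_iff.1 hb'
      obtain ⟨n, hn⟩ := hb o ho
      exact ⟨_, Ordinal.toZFSet_mem_toZFSet_iff.2 (Ordinal.natCast_lt_omega0 n), _,
        Ordinal.toZFSet_mem_toZFSet_iff.2 (hf n), ZFSet.mem_range.2 ⟨⟨n⟩, rfl⟩,
        Ordinal.toZFSet_mem_toZFSet_iff.2 hn⟩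
  · rintro ⟨f, hf, hb⟩
    have : ∀ n : ℕ, ∃ o : Ordinal.{u}, o < a ∧ ∀ c : Ordinal.{u}, c < a →
        ZFSet.pair (n : Ordinal.{u}).toZFSet c.toZFSet ∈ f.1 → c = o := by
      intro n
      by_cases h : ∃ c : Ordinal.{u}, c < a ∧ ZFSet.pair (n : Ordinal.{u}).toZFSet c.toZFSet ∈ f.1
      · obtain ⟨c, hc, hp⟩ := h
        exact ⟨c, hc, fun c' _ hp' => Ordinal.toZFSet_injective (hf _ _ hp' _ _ hp rfl)⟩
      · exact ⟨0, h0, fun c hc hp => absurd ⟨c, hc, hp⟩ h⟩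
    choose g hg hg' using this
    refine ⟨g, hg, fun b hba => ?_⟩
    obtain ⟨n, hn, c, hc, hp, hbc⟩ := hb _ (Ordinal.toZFSet_mem_toZFSet_iff.2 hba)
    obtain ⟨m, hm, rfl⟩ := Ordinal.mem_toZFSet_iff.1 hn
    obtain ⟨k, rfl⟩ := Ordinal.lt_omega0.1 hm
    obtain ⟨c, hca, rfl⟩ := Ordinal.mem_toZFSet_iff.1 hc
    exact ⟨k, hg' k c hca hp ▸ Ordinal.toZFSet_mem_toZFSet_iff.1 hbc⟩

/-! ### Stationarity below a regular cardinal -/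

section Regular

variable {l : Cardinal.{u}}

theorem cof_Iio_ord (hreg : l.IsRegular) : Order.cof (Set.Iio l.ord) = lift.{u + 1} l := by
  rw [Ordinal.cof_Iio, ← Ordinal.lift_cof, hreg.cof_ord]

theorem cof_Iio_ord_gt (hreg : l.IsRegular) (hunc : ℵ₀ < l) : ℵ₀ < Order.cof (Set.Iio l.ord) := by
  rw [cof_Iio_ord hreg, ← lift_aleph0.{u + 1, u}, lift_lt]; exact hunc

/-- A union of fewer than `l` nonstationary sets is nonstationary. -/
theorem exists_isStationaryIn_of_cover (hreg : l.IsRegular) (hunc : ℵ₀ < l) {ι : Type (u + 1)}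
    (hι : #ι < lift.{u + 1} l) {X : ZFSet.{u}} (hX : IsStationaryIn l.ord X) (Y : ι → ZFSet.{u})
    (hXY : ∀ x ∈ X, ∃ i, x ∈ Y i) : ∃ i, IsStationaryIn l.ord (Y i) := by
  have h : IsStationary (⋃ i, ordTrace l.ord (Y i)) := hX.mono fun a ha => by
    obtain ⟨i, hi⟩ := hXY a.1.toZFSet ha
    exact Set.mem_iUnion.2 ⟨i, hi⟩
  refine (isStationary_iUnion_iff (cof_Iio_ord_gt hreg hunc).ne' ?_).1 h
  rw [cof_Iio_ord hreg]
  simpa using hι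

/-- A club contains the supremum of any strictly increasing sequence of length `ω` of its
elements. -/
theorem isStationaryIn_cofOmega (hreg : l.IsRegular) (hunc : ℵ₀ < l) :
    IsStationaryIn l.ord (cofOmega l.ord) := by
  intro C hC
  have hlim : Order.IsSuccLimit l.ord := isSuccLimit_ord hreg.aleph0_le
  have hstep : ∀ a : Set.Iio l.ord, ∃ b ∈ C, a < b := fun a => by
    obtain ⟨b, hb, hab⟩ := hC.isCofinal ⟨Order.succ a.1, hlim.succ_lt a.2⟩
    exact ⟨b, hb, (Order.lt_succ a.1).trans_le hab⟩
  choose g hg hlt using hstep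
  let s : ℕ → Set.Iio l.ord := fun n => g^[n + 1] ⟨0, hreg.ord_pos⟩
  have hs : ∀ n, s (n + 1) = g (s n) := fun n => Function.iterate_succ_apply' _ _ _
  have hsC : ∀ n, s n ∈ C := fun n => by
    simp only [s, Function.iterate_succ_apply']; exact hg _
  have hbdd : BddAbove (Set.range s) := by
    refine .of_not_isCofinal fun h => (Order.cof_le h).not_gt ?_
    exact (mk_le_aleph0_iff.2 (Set.countable_range s).to_subtype).trans_lt
      (cof_Iio_ord_gt hreg hunc)
  obtain ⟨B, hB⟩ := hbdd
  have hle : ∀ n, (s n).1 ≤ ⨆ n, (s n).1 := fun n =>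
    le_ciSup (f := fun n => (s n).1) ⟨B.1, by rintro _ ⟨n, rfl⟩; exact hB ⟨n, rfl⟩⟩ n
  have hsup : ⨆ n, (s n).1 < l.ord :=
    (ciSup_le' fun n => show (s n).1 ≤ B.1 from hB ⟨n, rfl⟩).trans_lt B.2
  refine ⟨⟨⨆ n, (s n).1, hsup⟩, ?_, ?_⟩
  · refine mem_cofOmega.2 ⟨_, hsup, rfl, ?_⟩
    have hlts : ∀ n, (s n).1 < ⨆ n, (s n).1 := fun n =>
      (show (s n).1 < (s (n + 1)).1 by rw [hs]; exact hlt _).trans_le (hle (n + 1))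
    exact cof_eq_aleph0_iff.2 ⟨zero_le.trans_lt (hlts 0), fun n => (s n).1, hlts,
      fun b hb => exists_lt_of_lt_ciSup' hb⟩
  · refine hC.isLUB_mem (t := Set.range s) (by rintro _ ⟨n, rfl⟩; exact hsC n)
      (Set.range_nonempty s) ⟨by rintro _ ⟨n, rfl⟩; exact hle n, fun b hb => ?_⟩
    exact ciSup_le' fun n => show (s n).1 ≤ b.1 from hb ⟨n, rfl⟩

end Regular

/-! ### Ordinal definable choice -/

/-- The pairs `(T, X)` in `R` for which `X` has the least code. -/
noncomputable def uniformize (R : ZFSet.{u}) : ZFSet.{u} :=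
  R.sep fun p => ∃ T X, p = ZFSet.pair T X ∧ IsOD X ∧
    ∀ X', ZFSet.pair T X' ∈ R → IsOD X' → code X ≤ code X'

theorem mem_uniformize {R T X : ZFSet.{u}} : ZFSet.pair T X ∈ uniformize R ↔
    ZFSet.pair T X ∈ R ∧ IsOD X ∧ ∀ X', ZFSet.pair T X' ∈ R → IsOD X' → code X ≤ code X' := by
  rw [uniformize, ZFSet.mem_sep]
  refine and_congr_right fun _ => ⟨?_, fun h => ⟨T, X, rfl, h⟩⟩
  rintro ⟨T', X', e, h⟩
  obtain ⟨rfl, rfl⟩ := ZFSet.pair_injective e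
  exact h

theorem uniformize_unique {R T X X' : ZFSet.{u}} (h : ZFSet.pair T X ∈ uniformize R)
    (h' : ZFSet.pair T X' ∈ uniformize R) : X = X' := by
  obtain ⟨h1, h2, h3⟩ := mem_uniformize.1 h
  obtain ⟨h1', h2', h3'⟩ := mem_uniformize.1 h'
  have e := le_antisymm (h3 _ h1' h2') (h3' _ h1 h2)
  exact (val_code h2).unique (e ▸ val_code h2')

theorem exists_mem_uniformize {R T X : ZFSet.{u}} (h : ZFSet.pair T X ∈ R) (hX : IsOD X) :
    ∃ X', ZFSet.pair T X' ∈ uniformize R := by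
  let s : Set Ordinal.{u} := {c | ∃ X, ZFSet.pair T X ∈ R ∧ IsOD X ∧ code X = c}
  have hs : s.Nonempty := ⟨_, X, h, hX, rfl⟩
  obtain ⟨X', h1, h2, h3⟩ := csInf_mem hs
  exact ⟨X', mem_uniformize.2 ⟨h1, h2, fun X'' h4 h5 => h3 ▸ csInf_le' ⟨X'', h4, h5, rfl⟩⟩⟩

/-- Comparison of least codes is expressed through codes recognized in `V_θ`. -/
theorem isOD_uniformize {R : ZFSet.{u}} (hR : IsOD R) : IsOD (uniformize R) := by
  obtain ⟨b, hb⟩ := exists_bound_valIn (ZFSet.sUnion (ZFSet.sUnion R))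
  have hmem : ∀ {T X : ZFSet.{u}}, ZFSet.pair T X ∈ R → X ∈ ZFSet.sUnion (ZFSet.sUnion R) := fun {T X} h =>
    ZFSet.mem_sUnion_of_mem (y := X) (z := {T, X}) (by simp)
      (ZFSet.mem_sUnion_of_mem (z := ZFSet.pair T X) (by simp [ZFSet.pair]) h)
  refine isOD_of_dfn ![R] (by simpa) b fun θ hθ hbθ =>
    ⟨fun v => (v none).1 ∈ (v (some 0)).1 ∧ ∃ T X : levelSet θ, (v none).1 = ZFSet.pair T.1 X.1 ∧
      ∃ c : levelSet θ, ValIn c X ∧ ∀ c' X' : levelSet θ, c'.1 ∈ c.1 →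
        ZFSet.pair T.1 X'.1 ∈ (v (some 0)).1 → ¬ ValIn c' X', inferInstance, fun v h => ?_⟩
  beta_reduce
  rw [h 0, Matrix.cons_val_zero, uniformize, ZFSet.mem_sep]
  refine and_congr_right fun hv => ?_
  constructor
  · rintro ⟨T, X, e, hX, hmin⟩
    rw [e] at hv
    obtain ⟨hc, hXl, hval⟩ := hb θ hbθ X (hmem hv) hX
    have hT : T ∈ levelSet θ :=
      mem_lev.2 (rank_lt_of_pair.1.trans (mem_lev.1 (e ▸ (v none).2)))
    refine ⟨⟨T, hT⟩, ⟨X, hXl⟩, e, _, hval, fun c' X' hc' hX' hv' => ?_⟩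
    obtain ⟨o, ho, ho'⟩ := hv'.sound
    rw [ho] at hc'
    have h1 := Ordinal.toZFSet_mem_toZFSet_iff.1 hc'
    have h2 := hmin X'.1 hX' hv'.isOD
    exact (h1.trans_le (h2.trans (csInf_le' ho'))).false
  · rintro ⟨T, X, e, c, hc, hmin⟩
    refine ⟨T.1, X.1, e, hc.isOD, fun X' hX' hOD => ?_⟩
    obtain ⟨o, ho, ho'⟩ := hc.sound
    obtain ⟨hc', hXl', hval⟩ := hb θ hbθ X' (hmem hX') hOD
    by_contra hlt
    rw [not_le] at hlt
    refine hmin ⟨_, hc'⟩ ⟨X', hXl'⟩ ?_ hX' hval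
    rw [ho]
    exact Ordinal.toZFSet_mem_toZFSet_iff.2 (hlt.trans_le (csInf_le' ho'))

/-- The value of an ordinal definable function is ordinal definable. -/
theorem isOD_of_pair_mem {Q a T : ZFSet.{u}} (hQ : IsOD Q) (ha : IsOD a) (h : ZFSet.pair a T ∈ Q)
    (hu : ∀ T', ZFSet.pair a T' ∈ Q → T' = T) : IsOD T := by
  refine isOD_of_dfn ![Q, a] (Fin.forall_fin_two.2 ⟨hQ, ha⟩) 0 fun θ _ _ =>
    ⟨fun v => ∃ a' T, ZFSet.pair a' T ∈ (v (some 0)).1 ∧ (a' = (v (some 1)).1 ∧ (v none).1 ∈ T),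
      inferInstance, fun v h' => ?_⟩
  beta_reduce
  rw [h' 0, h' 1]
  constructor
  · intro hv
    exact ⟨a, T, h, rfl, hv⟩
  · rintro ⟨_, T', h1, rfl, h2⟩
    exact hu T' h1 ▸ h2

/-! ### The splitting tree -/

/-- `X` splits `T` into two sets that are stationary in `l`. -/
def Splits (l : Ordinal.{u}) (T X : ZFSet.{u}) : Prop :=
  X ⊆ T ∧ X ∈ statSet l ∧ T \ X ∈ statSet l

instance Dfn.sdiffMem (i j k : α) :
    Dfn fun v : α → levelSet θ => (v j).1 \ (v k).1 ∈ (v i).1 :=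
  (inferInstance : Dfn fun v : α → levelSet θ => ∃ d, d ∈ (v i).1 ∧
    ((∀ z, z ∈ d → z ∈ (v j).1 ∧ ¬ z ∈ (v k).1) ∧
      ∀ z, z ∈ (v j).1 → ¬ z ∈ (v k).1 → z ∈ d)).congr fun v => by
    constructor
    · intro h
      exact ⟨_, h, fun z hz => ZFSet.mem_sdiff.1 hz, fun z h1 h2 => ZFSet.mem_sdiff.2 ⟨h1, h2⟩⟩
    · rintro ⟨d, hd, h1, h2⟩
      have : d = (v j).1 \ (v k).1 := by
        ext z
        rw [ZFSet.mem_sdiff]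
        exact ⟨h1 z, fun h => h2 z h.1 h.2⟩
      exact this ▸ hd

/-- The set of all `(T, X)` such that `X` splits `T ⊆ l`. -/
noncomputable def splitSet (l : Ordinal.{u}) : ZFSet.{u} :=
  (l.toZFSet.powerset.prod l.toZFSet.powerset).sep fun p =>
    ∃ T X, p = ZFSet.pair T X ∧ Splits l T X

theorem mem_splitSet {l : Ordinal.{u}} {T X : ZFSet.{u}} :
    ZFSet.pair T X ∈ splitSet l ↔ T ⊆ l.toZFSet ∧ Splits l T X := by
  rw [splitSet, ZFSet.mem_sep, ZFSet.pair_mem_prod, ZFSet.mem_powerset, ZFSet.mem_powerset]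
  constructor
  · rintro ⟨⟨h1, h2⟩, T', X', e, h⟩
    obtain ⟨rfl, rfl⟩ := ZFSet.pair_injective e
    exact ⟨h1, h⟩
  · rintro ⟨h1, h⟩
    exact ⟨⟨h1, (mem_statSet.1 h.2.1).1⟩, T, X, rfl, h⟩

theorem isOD_splitSet (l : Ordinal.{u}) : IsOD (splitSet l) := by
  refine isOD_of_dfn ![l.toZFSet, statSet l]
    (Fin.forall_fin_two.2 ⟨isOD_toZFSet l, isOD_statSet l⟩) 0 fun θ _ _ =>
    ⟨fun v => ∃ T X : levelSet θ, (v none).1 = ZFSet.pair T.1 X.1 ∧ (T.1 ⊆ (v (some 0)).1 ∧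
      (X.1 ⊆ T.1 ∧ X.1 ∈ (v (some 1)).1 ∧ T.1 \ X.1 ∈ (v (some 1)).1)), inferInstance,
      fun v h => ?_⟩
  beta_reduce
  rw [h 0, h 1]
  constructor
  · intro hv
    obtain ⟨-, T, X, e, -⟩ := ZFSet.mem_sep.1 hv
    rw [e, mem_splitSet] at hv
    have hr := mem_lev.1 (e ▸ (v none).2)
    exact ⟨⟨T, mem_lev.2 (rank_lt_of_pair.1.trans hr)⟩,
      ⟨X, mem_lev.2 (rank_lt_of_pair.2.trans hr)⟩, e, hv⟩
  · rintro ⟨T, X, e, hv⟩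
    rw [e]
    exact mem_splitSet.2 hv

/-- `y` lies in a value of the relation `H` at `T`. For `H` a function choosing a splitting of each
set, this says on which side of the splitting of `T` the point `y` lies. -/
def InHalf (H T y : ZFSet.{u}) : Prop :=
  ∃ T' X, ZFSet.pair T' X ∈ H ∧ (T' = T ∧ y ∈ X)

instance InHalf.dfn (i j k : α) :
    Dfn fun v : α → levelSet θ => InHalf (v i).1 (v j).1 (v k).1 := by
  unfold InHalf; infer_instance

/-- The node at level `a` of the branch of `x` through the splitting tree of `E`: the set of those
`y` in `E` that lie on the same side as `x` of each splitting at an earlier level. -/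
noncomputable def branch (H E x : ZFSet.{u}) (a : Ordinal.{u}) : ZFSet.{u} :=
  E.sep fun y => ∀ b : Set.Iio a, InHalf H (branch H E x b.1) y ↔ InHalf H (branch H E x b.1) x
termination_by a
decreasing_by exact b.2

section Branch

variable {H E x y : ZFSet.{u}} {a k : Ordinal.{u}}

theorem mem_branch : y ∈ branch H E x a ↔ y ∈ E ∧ ∀ b < a,
    (InHalf H (branch H E x b) y ↔ InHalf H (branch H E x b) x) := by
  rw [branch, ZFSet.mem_sep]
  exact and_congr_right fun _ => ⟨fun h b hb => h ⟨b, hb⟩, fun h b => h b.1 b.2⟩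

theorem branch_subset : branch H E x a ⊆ E := fun _ h => (mem_branch.1 h).1

theorem branch_anti {b : Ordinal.{u}} (h : a ≤ b) : branch H E x b ⊆ branch H E x a :=
  fun _ hy => mem_branch.2 ⟨(mem_branch.1 hy).1, fun c hc => (mem_branch.1 hy).2 c (hc.trans_le h)⟩

/-- The sequence of the first `k` nodes of the branch of `x`. -/
noncomputable def branchSeq (H E x : ZFSet.{u}) (k : Ordinal.{u}) : ZFSet.{u} :=
  seqGraph k fun a => branch H E x a.1

theorem pair_mem_seqGraph {S : Set.Iio k → ZFSet.{u}} {z T : ZFSet.{u}} :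
    ZFSet.pair z T ∈ seqGraph k S ↔ ∃ a : Set.Iio k, z = a.1.toZFSet ∧ T = S a := by
  rw [seqGraph, ZFSet.mem_range]
  constructor
  · rintro ⟨a, e⟩
    obtain ⟨rfl, rfl⟩ := ZFSet.pair_injective e
    exact ⟨a, rfl, rfl⟩
  · rintro ⟨a, rfl, rfl⟩
    exact ⟨a, rfl⟩

/-- An initial segment of the branch is the union of the partial sequences obeying the recursion,
and membership in such a sequence is expressed in `V_θ`. -/
theorem isOD_branchSeq (hH : IsOD H) (hE : IsOD E) (hx : IsOD x) (k : Ordinal.{u}) :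
    IsOD (branchSeq H E x k) := by
  refine isOD_of_dfn ![H, E, x, k.toZFSet] (by simp [Fin.forall_fin_succ, *, isOD_toZFSet])
    (branchSeq H E x k).rank fun θ hθ hr =>
    ⟨fun v => ∃ q : levelSet θ, (v none).1 ∈ q.1 ∧
      (∃ a T : levelSet θ, (v none).1 = ZFSet.pair a.1 T.1) ∧
      ∀ a T, ZFSet.pair a T ∈ q.1 → a ∈ (v (some 3)).1 ∧ T ⊆ (v (some 1)).1 ∧
        (∀ b, b ∈ a → ∃ b' T', ZFSet.pair b' T' ∈ q.1 ∧ b' = b) ∧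
        ∀ y, y ∈ (v (some 1)).1 → (y ∈ T ↔ ∀ b T', ZFSet.pair b T' ∈ q.1 → b ∈ a →
          (InHalf (v (some 0)).1 T' y ↔ InHalf (v (some 0)).1 T' (v (some 2)).1)),
      inferInstance, fun v h => ?_⟩
  beta_reduce
  have h0 : (v (some 0)).1 = H := h 0
  have h1 : (v (some 1)).1 = E := h 1
  have h2 : (v (some 2)).1 = x := h 2
  have h3 : (v (some 3)).1 = k.toZFSet := h 3
  rw [h0, h1, h2, h3]
  constructor
  · intro hv
    refine ⟨⟨_, mem_lev.2 hr⟩, hv, ?_, fun z T hzT => ?_⟩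
    · obtain ⟨a, e⟩ := ZFSet.mem_range.1 hv
      have hl := pair_mem_lev (mem_lev.2 hr) (e ▸ hv)
      exact ⟨⟨_, hl.1⟩, ⟨_, hl.2⟩, e.symm⟩
    · obtain ⟨a, rfl, rfl⟩ := pair_mem_seqGraph.1 hzT
      refine ⟨Ordinal.toZFSet_mem_toZFSet_iff.2 a.2, branch_subset, fun b hb => ?_, fun y hy => ?_⟩
      · obtain ⟨b, hba, rfl⟩ := Ordinal.mem_toZFSet_iff.1 hb
        exact ⟨_, _, pair_mem_seqGraph.2 ⟨⟨b, hba.trans a.2⟩, rfl, rfl⟩, rfl⟩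
      · rw [mem_branch, and_iff_right hy]
        constructor
        · intro h' z T' hzT' hz
          obtain ⟨b, rfl, rfl⟩ := pair_mem_seqGraph.1 hzT'
          exact h' b.1 (Ordinal.toZFSet_mem_toZFSet_iff.1 hz)
        · intro h' b hb
          exact h' _ _ (pair_mem_seqGraph.2 ⟨⟨b, hb.trans a.2⟩, rfl, rfl⟩)
            (Ordinal.toZFSet_mem_toZFSet_iff.2 hb)
  · rintro ⟨q, hvq, ⟨z, T, e⟩, hq⟩
    have key : ∀ a : Ordinal.{u}, ∀ T, ZFSet.pair a.toZFSet T ∈ q.1 → T = branch H E x a := by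
      intro a
      induction a using WellFoundedLT.induction with
      | ind a ih =>
        intro T hT
        obtain ⟨-, hTE, hex, hT'⟩ := hq _ _ hT
        ext y
        rw [mem_branch]
        constructor
        · intro hy
          refine ⟨hTE hy, fun b hb => ?_⟩
          obtain ⟨_, T', hbT, rfl⟩ := hex _ (Ordinal.toZFSet_mem_toZFSet_iff.2 hb)
          rw [← ih b hb T' hbT]
          exact (hT' y (hTE hy)).1 hy _ _ hbT (Ordinal.toZFSet_mem_toZFSet_iff.2 hb)
        · rintro ⟨hy, h'⟩
          refine (hT' y hy).2 fun z T' hzT hz => ?_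
          obtain ⟨b, hb, rfl⟩ := Ordinal.mem_toZFSet_iff.1 hz
          rw [ih b hb T' hzT]
          exact h' b hb
    rw [e] at hvq ⊢
    obtain ⟨hz, -⟩ := hq _ _ hvq
    obtain ⟨a, ha, hz⟩ := Ordinal.mem_toZFSet_iff.1 hz
    rw [← hz] at hvq ⊢
    exact pair_mem_seqGraph.2 ⟨⟨a, ha⟩, rfl, key a _ hvq⟩

theorem isOD_seq_apply {S : Set.Iio k → ZFSet.{u}} (h : IsOD (seqGraph k S)) (a : Set.Iio k) :
    IsOD (S a) := by
  refine isOD_of_pair_mem h (isOD_toZFSet a.1) (pair_mem_seqGraph.2 ⟨a, rfl, rfl⟩) fun T hT => ?_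
  obtain ⟨b, e, rfl⟩ := pair_mem_seqGraph.1 hT
  rw [Subtype.ext (Ordinal.toZFSet_injective e)]

theorem isOD_branch (hH : IsOD H) (hE : IsOD E) (hx : IsOD x) (a : Ordinal.{u}) :
    IsOD (branch H E x a) :=
  isOD_seq_apply (isOD_branchSeq hH hE hx (a + 1)) ⟨a, Set.mem_Iio.2 (Order.lt_add_one_iff.2 le_rfl)⟩

/-- The turns that the branch of `x` takes below `k`, as a subset of `k`. It is an element of HOD
for ordinal definable data, which bounds the number of branches. -/
noncomputable def turns (H E x : ZFSet.{u}) (k : Ordinal.{u}) : ZFSet.{u} :=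
  k.toZFSet.sep fun z => ∃ a : Ordinal.{u}, z = a.toZFSet ∧ InHalf H (branch H E x a) x

theorem mem_turns (ha : a < k) : a.toZFSet ∈ turns H E x k ↔ InHalf H (branch H E x a) x := by
  rw [turns, ZFSet.mem_sep, and_iff_right (Ordinal.toZFSet_mem_toZFSet_iff.2 ha)]
  refine ⟨?_, fun h => ⟨a, rfl, h⟩⟩
  rintro ⟨b, e, h⟩
  exact Ordinal.toZFSet_injective e ▸ h

theorem isOD_turns (hH : IsOD H) (hE : IsOD E) (hx : IsOD x) (k : Ordinal.{u}) :
    IsOD (turns H E x k) := by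
  refine isOD_of_dfn ![H, branchSeq H E x k, x]
    (by simp [Fin.forall_fin_succ, *, isOD_branchSeq]) 0 fun θ hθ hr =>
    ⟨fun v => ∃ a T, ZFSet.pair a T ∈ (v (some 1)).1 ∧
      ((v none).1 = a ∧ InHalf (v (some 0)).1 T (v (some 2)).1), inferInstance, fun v h => ?_⟩
  beta_reduce
  have h0 : (v (some 0)).1 = H := h 0
  have h1 : (v (some 1)).1 = branchSeq H E x k := h 1
  have h2 : (v (some 2)).1 = x := h 2
  rw [h0, h1, h2]
  constructor
  · intro hv
    obtain ⟨hk, a, e, ha⟩ := ZFSet.mem_sep.1 hv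
    rw [e, Ordinal.toZFSet_mem_toZFSet_iff] at hk
    exact ⟨_, _, pair_mem_seqGraph.2 ⟨⟨a, hk⟩, rfl, rfl⟩, e, ha⟩
  · rintro ⟨z, T, hzT, e, hT⟩
    obtain ⟨a, rfl, rfl⟩ := pair_mem_seqGraph.1 hzT
    rw [e]
    exact (mem_turns a.2).2 hT

/-- A node is determined by the turns that lead to it. -/
theorem branch_eq_of_turns_eq {x' : ZFSet.{u}} (h : turns H E x k = turns H E x' k) (ha : a ≤ k) :
    branch H E x a = branch H E x' a := by
  induction a using WellFoundedLT.induction with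
  | ind a ih =>
    ext y
    rw [mem_branch, mem_branch]
    refine and_congr_right fun _ => forall₂_congr fun b hb => ?_
    have hbk := hb.trans_le ha
    rw [← mem_turns hbk, ← mem_turns hbk, h, ih b hb hbk.le]

end Branch

/-! ### Set-theoretic notions evaluated in HOD -/

section Absolute

theorem HOD_mem {x y : HOD.{u}} : HOD.mem x y ↔ x.1 ∈ y.1 := Iff.rfl

theorem sub_HOD {x y : HOD.{u}} : SetModel.Sub HOD.mem x y ↔ x.1 ⊆ y.1 :=
  ⟨fun h z hz => h ⟨z, mem_HOD_of_mem x.2 hz⟩ hz, fun h _ hz => h hz⟩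

theorem isUPair_HOD {p x y : HOD.{u}} :
    SetModel.IsUPair HOD.mem p x y ↔ p.1 = ({x.1, y.1} : ZFSet) := by
  constructor
  · intro h
    ext z
    rw [ZFSet.mem_pair]
    constructor
    · intro hz
      simpa [Subtype.ext_iff] using (h ⟨z, mem_HOD_of_mem p.2 hz⟩).1 hz
    · rintro (rfl | rfl)
      · exact (h x).2 (Or.inl rfl)
      · exact (h y).2 (Or.inr rfl)
  · intro h z
    rw [HOD_mem, h, ZFSet.mem_pair, Subtype.ext_iff, Subtype.ext_iff]

theorem isOPair_HOD {p x y : HOD.{u}} :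
    SetModel.IsOPair HOD.mem p x y ↔ p.1 = ZFSet.pair x.1 y.1 := by
  simp only [SetModel.IsOPair, isUPair_HOD]
  constructor
  · rintro ⟨a, b, ha, hb, h⟩
    rw [h, ha, hb, ZFSet.pair_eq_singleton]; rfl
  · intro h
    exact ⟨⟨_, upair_mem_HOD x.2 x.2⟩, ⟨_, upair_mem_HOD x.2 y.2⟩, rfl, rfl, by
      rw [h]; simp [ZFSet.pair]⟩

theorem maps_HOD {f x y : HOD.{u}} :
    SetModel.Maps HOD.mem f x y ↔ ZFSet.pair x.1 y.1 ∈ f.1 := by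
  simp only [SetModel.Maps, isOPair_HOD]
  constructor
  · rintro ⟨p, hp, h⟩
    rw [← hp]; exact h
  · intro h
    exact ⟨⟨_, mem_HOD_of_mem f.2 h⟩, rfl, h⟩

theorem exists_HOD_ord {x : HOD.{u}} {o : Ordinal.{u}} (h : HOD.mem x (HOD.ord o)) :
    ∃ a < o, x = HOD.ord a := by
  obtain ⟨a, ha, e⟩ := Ordinal.mem_toZFSet_iff.1 h
  exact ⟨a, ha, Subtype.ext e.symm⟩

theorem isOrd_HOD_ord (o : Ordinal.{u}) : SetModel.IsOrd HOD.mem (HOD.ord o) := by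
  refine ⟨fun y hy => sub_HOD.2 ((ZFSet.isOrdinal_toZFSet o).isTransitive _ hy), fun y hy z hz => ?_⟩
  obtain ⟨a, -, rfl⟩ := exists_HOD_ord hy
  exact sub_HOD.2 ((ZFSet.isOrdinal_toZFSet a).isTransitive _ hz)

theorem isOmega_HOD : SetModel.IsOmega HOD.mem (HOD.ord Ordinal.omega0.{u}) := by
  refine ⟨⟨isOrd_HOD_ord _, ⟨HOD.ord 0, ?_⟩, fun y hy => ?_⟩, fun y hy hlim => ?_⟩
  · exact Ordinal.toZFSet_mem_toZFSet_iff.2 Ordinal.omega0_pos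
  · obtain ⟨a, ha, rfl⟩ := exists_HOD_ord hy
    exact ⟨HOD.ord (Order.succ a), Ordinal.toZFSet_mem_toZFSet_iff.2
      (Ordinal.isSuccLimit_omega0.succ_lt ha), Ordinal.toZFSet_mem_toZFSet_iff.2 (Order.lt_succ a)⟩
  · obtain ⟨a, ha, rfl⟩ := exists_HOD_ord hy
    obtain ⟨n, rfl⟩ := Ordinal.lt_omega0.1 ha
    obtain ⟨-, ⟨z, hz⟩, h⟩ := hlim
    cases n with
    | zero =>
      obtain ⟨b, hb, -⟩ := exists_HOD_ord hz
      simp at hb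
    | succ n =>
      obtain ⟨z, hz, hnz⟩ := h (HOD.ord n)
        (Ordinal.toZFSet_mem_toZFSet_iff.2 (Nat.cast_lt.2 n.lt_succ_self))
      obtain ⟨b, hb, rfl⟩ := exists_HOD_ord hz
      have hb' := Ordinal.toZFSet_mem_toZFSet_iff.1 hnz
      rw [Nat.cast_succ, Order.lt_add_one_iff] at hb
      exact (hb'.trans_le hb).false

/-- A bijection in HOD is a bijection; only its surjectivity is recorded. -/
theorem card_le_of_isBijection {f d c : HOD.{u}} (h : SetModel.IsBijection HOD.mem f d c) :
    c.1.card ≤ d.1.card := by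
  obtain ⟨⟨h1, h2⟩, -, h3⟩ := h
  have : ∀ y : c.1, ∃ x : d.1, ZFSet.pair x.1 y.1 ∈ f.1 := by
    rintro ⟨y, hy⟩
    obtain ⟨x, hx, -⟩ := h3 ⟨y, mem_HOD_of_mem c.2 hy⟩ hy
    obtain ⟨p, hp, hpf⟩ := hx
    obtain ⟨x', y', hx', hp'⟩ := h1 p hpf
    rw [isOPair_HOD] at hp hp'
    obtain ⟨e1, e2⟩ := ZFSet.pair_injective (hp.symm.trans hp')
    exact ⟨⟨x', hx'⟩, by rw [← e1]; exact hp ▸ hpf⟩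
  choose g hg using this
  have hinj : Function.Injective g := by
    intro y y' e
    have hy := hg y
    have hy' := hg y'
    rw [← e] at hy'
    obtain ⟨w, -, hw⟩ := h2 ⟨(g y).1, mem_HOD_of_mem d.2 (g y).2⟩ (g y).2
    have e1 := hw ⟨y.1, mem_HOD_of_mem c.2 y.2⟩ (maps_HOD.2 hy)
    have e2 := hw ⟨y'.1, mem_HOD_of_mem c.2 y'.2⟩ (maps_HOD.2 hy')
    exact Subtype.ext (congrArg (fun z : HOD.{u} => z.1) (e1.trans e2.symm))
  have := mk_le_of_injective hinj
  rwa [ZFSet.cardinalMk_coe_sort, ZFSet.cardinalMk_coe_sort, lift_le] at this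

theorem mk_subsets_le_of_isTwoPow {m k : Ordinal.{u}}
    (h : SetModel.IsTwoPow HOD.mem (HOD.ord m) (HOD.ord k)) :
    #{b : ZFSet.{u} // b ⊆ k.toZFSet ∧ b ∈ HOD} ≤ lift.{u + 1} m.card := by
  obtain ⟨-, p, hp, f, hf⟩ := h
  have h1 := card_le_of_isBijection hf
  have h2 : (HOD.ord m).1.card = m.card := Ordinal.card_toZFSet m
  rw [h2, ← lift_le.{u + 1}, ← ZFSet.cardinalMk_coe_sort] at h1
  refine le_trans (mk_le_of_injective (f := fun b => (⟨b.1, ?_⟩ : p.1)) ?_) h1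
  · exact (hp ⟨b.1, b.2.2⟩).2 (sub_HOD.2 b.2.1)
  · intro b b' e
    exact Subtype.ext (congrArg (fun z : p.1 => z.1) e)

/-- Cardinals of V are cardinals of HOD. -/
theorem isCard_HOD (l : Cardinal.{u}) : SetModel.IsCard HOD.mem (HOD.ord l.ord) := by
  refine ⟨isOrd_HOD_ord _, ?_⟩
  rintro y hy ⟨f, hf⟩
  obtain ⟨a, ha, rfl⟩ := exists_HOD_ord hy
  have := card_le_of_isBijection hf
  have h1 : (HOD.ord l.ord).1.card = l := (Ordinal.card_toZFSet _).trans (card_ord l)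
  have h2 : (HOD.ord a).1.card = a.card := Ordinal.card_toZFSet a
  rw [h1, h2] at this
  exact (lt_ord.1 ha).not_ge this

end Absolute

/-! ### An ordinal definable stationary set without ordinal definable splitting -/

section Atom

variable {l : Cardinal.{u}}

theorem not_isStationaryIn_empty (l : Ordinal.{u}) : ¬ IsStationaryIn l ∅ := by
  intro h
  obtain ⟨a, ha⟩ := h.nonempty
  exact ZFSet.notMem_empty a.1.toZFSet ha

theorem isStationaryIn_mono {l : Ordinal.{u}} {X Y : ZFSet.{u}} (h : IsStationaryIn l X)
    (hXY : X ⊆ Y) : IsStationaryIn l Y :=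
  IsStationary.mono h fun a ha => hXY (show a.1.toZFSet ∈ X from ha)

/-- If HOD has fewer than `l` subsets of `k`, then some branch of the splitting tree consists of
stationary sets up to `k`. Otherwise `E` would be covered by the nonstationary nodes below level
`k`, and a node is given by its level and its turns, so there are fewer than `l` of them. -/
theorem exists_stationary_branch (hreg : l.IsRegular) (hunc : ℵ₀ < l) {H E : ZFSet.{u}}
    (hH : IsOD H) (hE : IsOD E) (hEl : E ⊆ l.ord.toZFSet) (hEs : IsStationaryIn l.ord E)
    {k : Ordinal.{u}} (hk : k < l.ord)
    (hcard : #{b : ZFSet.{u} // b ⊆ k.toZFSet ∧ b ∈ HOD} < lift.{u + 1} l) :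
    ∃ x ∈ E, ∀ a < k, IsStationaryIn l.ord (branch H E x a) := by
  classical
  by_contra! hcon
  let P : Set.Iio k × {b : ZFSet.{u} // b ⊆ k.toZFSet ∧ b ∈ HOD} → ZFSet.{u} → Prop := fun i x =>
    x ∈ E ∧ turns H E x k = i.2.1 ∧ ¬ IsStationaryIn l.ord (branch H E x i.1.1)
  -- the node of level `i.1` with turns `i.2`, if it exists and is nonstationary
  let Y := fun i => if h : ∃ x, P i x then branch H E h.choose i.1.1 else ∅
  have hι : #(Set.Iio k × {b : ZFSet.{u} // b ⊆ k.toZFSet ∧ b ∈ HOD}) < lift.{u + 1} l := by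
    rw [mk_prod, lift_id, lift_id, mk_Iio_ordinal]
    refine mul_lt_of_lt ?_ (lift_lt.2 (lt_ord.1 hk)) hcard
    rw [← lift_aleph0.{u + 1, u}, lift_le]; exact hreg.aleph0_le
  obtain ⟨i, hi⟩ := exists_isStationaryIn_of_cover hreg hunc hι hEs Y fun x hx => by
    obtain ⟨a, ha, hns⟩ := hcon x hx
    have hxOD : IsOD x := by
      obtain ⟨o, -, rfl⟩ := Ordinal.mem_toZFSet_iff.1 (hEl hx)
      exact isOD_toZFSet o
    have hsub : turns H E x k ⊆ k.toZFSet := ZFSet.sep_subset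
    let i : Set.Iio k × {b : ZFSet.{u} // b ⊆ k.toZFSet ∧ b ∈ HOD} :=
      (⟨a, ha⟩, ⟨turns H E x k, hsub, mem_HOD_of_subset (isOD_turns hH hE hxOD k) hsub⟩)
    have hP : ∃ x, P i x := ⟨x, hx, rfl, hns⟩
    refine ⟨i, ?_⟩
    simp only [Y, dif_pos hP]
    rw [branch_eq_of_turns_eq hP.choose_spec.2.1 ha.le]
    exact mem_branch.2 ⟨hx, fun _ _ => Iff.rfl⟩
  by_cases h : ∃ x, P i x
  · simp only [Y, dif_pos h] at hi
    exact h.choose_spec.2.2 hi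
  · simp only [Y, dif_neg h] at hi
    exact not_isStationaryIn_empty _ hi

/-- Whichever half contains `x`, the other half of a split node leaves the branch. -/
theorem stationary_diff_of_split {H E x T X : ZFSet.{u}} {l a : Ordinal.{u}}
    (hT : T = branch H E x a) (hX : ZFSet.pair T X ∈ H)
    (hu : ∀ X', ZFSet.pair T X' ∈ H → X' = X) (hs : Splits l T X) :
    IsStationaryIn l (T \ branch H E x (a + 1)) := by
  have hhalf : ∀ y, InHalf H T y ↔ y ∈ X := by
    intro y
    constructor
    · rintro ⟨_, X', h, rfl, hy⟩
      exact hu X' h ▸ hy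
    · intro hy
      exact ⟨T, X, hX, rfl, hy⟩
  have hmem : ∀ y, y ∈ branch H E x (a + 1) → (y ∈ X ↔ x ∈ X) := by
    intro y hy
    rw [← hhalf, ← hhalf, hT]
    exact (mem_branch.1 hy).2 a (Order.lt_add_one_iff.2 le_rfl)
  by_cases hx : x ∈ X
  · refine isStationaryIn_mono (mem_statSet.1 hs.2.2).2 fun y hy => ?_
    rw [ZFSet.mem_sdiff] at hy ⊢
    exact ⟨hy.1, fun h => hy.2 ((hmem y h).2 hx)⟩
  · refine isStationaryIn_mono (mem_statSet.1 hs.2.1).2 fun y hy => ?_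
    rw [ZFSet.mem_sdiff]
    exact ⟨hs.1 hy, fun h => hx ((hmem y h).1 hy)⟩

/-- The pieces split off along a branch up to level `k`. The piece with index `0` also takes the
points that never leave the branch, so that the pieces cover `E`. -/
noncomputable def piece (H E x : ZFSet.{u}) (k : Ordinal.{u}) (a : Ordinal.{u}) : ZFSet.{u} :=
  E.sep fun y => (a = 0 ∧ ∀ b < k, b ≠ 0 → ¬ (y ∈ branch H E x b ∧ y ∉ branch H E x (b + 1))) ∨
    (a ≠ 0 ∧ (y ∈ branch H E x a ∧ y ∉ branch H E x (a + 1)))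

theorem mem_branch_succ {H E x y : ZFSet.{u}} {a : Ordinal.{u}} :
    y ∈ branch H E x (a + 1) ↔ y ∈ branch H E x a ∧
      (InHalf H (branch H E x a) y ↔ InHalf H (branch H E x a) x) := by
  constructor
  · intro h
    exact ⟨branch_anti (le_add_of_nonneg_right zero_le) h,
      (mem_branch.1 h).2 a (Order.lt_add_one_iff.2 le_rfl)⟩
  · rintro ⟨h1, h2⟩
    refine mem_branch.2 ⟨(mem_branch.1 h1).1, fun b hb => ?_⟩
    obtain h | rfl := (Order.lt_add_one_iff.1 hb).lt_or_eq
    · exact (mem_branch.1 h1).2 b h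
    · exact h2

theorem isOD_pieces {H E x : ZFSet.{u}} (hH : IsOD H) (hE : IsOD E) (hx : IsOD x)
    (k : Ordinal.{u}) : IsOD (seqGraph k fun a => piece H E x k a.1) := by
  refine isOD_of_dfn ![H, E, x, branchSeq H E x k]
    (by simp [Fin.forall_fin_succ, *, isOD_branchSeq]) 0 fun θ hθ hr =>
    ⟨fun v => ∃ z D B : levelSet θ, (v none).1 = ZFSet.pair z.1 D.1 ∧
      ZFSet.pair z.1 B.1 ∈ (v (some 3)).1 ∧ D.1 ⊆ (v (some 1)).1 ∧
      ∀ y, y ∈ (v (some 1)).1 → (y ∈ D.1 ↔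
        ((∀ e, e ∈ z.1 → False) ∧ ∀ b T, ZFSet.pair b T ∈ (v (some 3)).1 → (¬ ∀ e, e ∈ b → False) →
          ¬ (y ∈ T ∧ ¬ (InHalf (v (some 0)).1 T y ↔ InHalf (v (some 0)).1 T (v (some 2)).1))) ∨
        ((¬ ∀ e, e ∈ z.1 → False) ∧ (y ∈ B.1 ∧
          ¬ (InHalf (v (some 0)).1 B.1 y ↔ InHalf (v (some 0)).1 B.1 (v (some 2)).1)))),
      inferInstance, fun v h => ?_⟩
  beta_reduce
  have h0 : (v (some 0)).1 = H := h 0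
  have h1 : (v (some 1)).1 = E := h 1
  have h2 : (v (some 2)).1 = x := h 2
  have h3 : (v (some 3)).1 = branchSeq H E x k := h 3
  have hlev : branchSeq H E x k ∈ levelSet θ := h3 ▸ (v (some 3)).2
  rw [h0, h1, h2, h3]
  have hz : ∀ a : Ordinal.{u}, (∀ e, e ∈ a.toZFSet → False) ↔ a = 0 := by
    intro a
    constructor
    · intro h
      by_contra ha
      exact h (0 : Ordinal.{u}).toZFSet (Ordinal.toZFSet_mem_toZFSet_iff.2 (pos_iff_ne_zero.2 ha))
    · rintro rfl e he
      simp at he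
  have hd : ∀ y b, (y ∈ branch H E x b ∧ y ∉ branch H E x (b + 1)) ↔ y ∈ branch H E x b ∧
      ¬ (InHalf H (branch H E x b) y ↔ InHalf H (branch H E x b) x) := by
    intro y b
    rw [mem_branch_succ]; tauto
  have key : ∀ (a : Ordinal.{u}) (D : ZFSet.{u}), a < k → (D = piece H E x k a ↔ D ⊆ E ∧
      ∀ y, y ∈ E → (y ∈ D ↔ ((∀ e, e ∈ a.toZFSet → False) ∧
        ∀ b T, ZFSet.pair b T ∈ branchSeq H E x k → (¬ ∀ e, e ∈ b → False) →
          ¬ (y ∈ T ∧ ¬ (InHalf H T y ↔ InHalf H T x))) ∨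
        ((¬ ∀ e, e ∈ a.toZFSet → False) ∧ (y ∈ branch H E x a ∧
          ¬ (InHalf H (branch H E x a) y ↔ InHalf H (branch H E x a) x))))) := by
    intro a D ha
    have hb : ∀ y, (∀ b T, ZFSet.pair b T ∈ branchSeq H E x k → (¬ ∀ e, e ∈ b → False) →
          ¬ (y ∈ T ∧ ¬ (InHalf H T y ↔ InHalf H T x))) ↔
        ∀ b < k, b ≠ 0 → ¬ (y ∈ branch H E x b ∧ y ∉ branch H E x (b + 1)) := by
      intro y
      constructor
      · intro h b hb hb0
        rw [hd]
        exact h _ _ (pair_mem_seqGraph.2 ⟨⟨b, hb⟩, rfl, rfl⟩) (mt (hz b).1 hb0)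
      · intro h w T hw hw0
        obtain ⟨b, rfl, rfl⟩ := pair_mem_seqGraph.1 hw
        rw [← hd]
        exact h b.1 b.2 (mt (hz b.1).2 hw0)
    simp only [hb, ← hd]
    simp only [hz]
    constructor
    · rintro rfl
      exact ⟨ZFSet.sep_subset, fun y hy => by rw [piece, ZFSet.mem_sep, and_iff_right hy]⟩
    · rintro ⟨hD, hy⟩
      ext y
      rw [piece, ZFSet.mem_sep]
      exact ⟨fun h => ⟨hD h, (hy y (hD h)).1 h⟩, fun h => (hy y h.1).2 h.2⟩
  constructor
  · intro hv
    obtain ⟨a, e⟩ := ZFSet.mem_range.1 hv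
    have hr := mem_lev.1 (e ▸ (v none).2)
    have hB : ZFSet.pair a.1.toZFSet (branch H E x a.1) ∈ branchSeq H E x k :=
      pair_mem_seqGraph.2 ⟨a, rfl, rfl⟩
    exact ⟨⟨_, mem_lev.2 (rank_lt_of_pair.1.trans hr)⟩, ⟨_, mem_lev.2 (rank_lt_of_pair.2.trans hr)⟩,
      ⟨_, (pair_mem_lev hlev hB).2⟩, e.symm, hB, (key a.1 _ a.2).1 rfl⟩
  · rintro ⟨z, D, B, e, hzB, h⟩
    obtain ⟨a, hza, hB⟩ := pair_mem_seqGraph.1 hzB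
    rw [hza, hB] at h
    rw [e, hza, (key a.1 _ a.2).2 h]
    exact pair_mem_seqGraph.2 ⟨a, rfl, rfl⟩

/-- If every ordinal definable stationary subset of `cof(ω) ∩ l` splits, then HOD contains a
partition into `k` stationary sets. -/
theorem exists_partition_of_split (hreg : l.IsRegular) (hunc : ℵ₀ < l)
    (hsplit : ∀ T, IsOD T → T ⊆ cofOmega l.ord → IsStationaryIn l.ord T →
      ∃ X, IsOD X ∧ Splits l.ord T X)
    {k : Ordinal.{u}} (hk0 : 0 < k) (hk : k < l.ord)
    (hcard : #{b : ZFSet.{u} // b ⊆ k.toZFSet ∧ b ∈ HOD} < lift.{u + 1} l) :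
    ∃ S : Set.Iio k → ZFSet.{u}, IsStationaryPartition l.ord k S ∧ seqGraph k S ∈ HOD := by
  set H := uniformize (splitSet l.ord) with hHdef
  set E := cofOmega l.ord with hEdef
  have hH : IsOD H := isOD_uniformize (isOD_splitSet _)
  have hE : IsOD E := isOD_cofOmega _
  have hEl : E ⊆ l.ord.toZFSet := cofOmega_subset _
  obtain ⟨x, hxE, hx⟩ := exists_stationary_branch hreg hunc hH hE hEl
    (isStationaryIn_cofOmega hreg hunc) hk hcard
  have hxOD : IsOD x := by
    obtain ⟨o, -, rfl⟩ := Ordinal.mem_toZFSet_iff.1 (hEl hxE)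
    exact isOD_toZFSet o
  have hdiff : ∀ a < k, IsStationaryIn l.ord (branch H E x a \ branch H E x (a + 1)) := by
    intro a ha
    obtain ⟨X, hX, hs⟩ := hsplit _ (isOD_branch hH hE hxOD a) branch_subset (hx a ha)
    obtain ⟨X', hX'⟩ := exists_mem_uniformize
      (mem_splitSet.2 ⟨fun y hy => hEl (branch_subset hy), hs⟩) hX
    exact stationary_diff_of_split rfl hX' (fun _ h => uniformize_unique h hX')
      (mem_splitSet.1 (mem_uniformize.1 hX').1).2
  have hlt : ∀ {a b : Ordinal.{u}} {y}, y ∈ branch H E x b → y ∉ branch H E x (a + 1) → b ≤ a :=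
    fun {a b y} hb ha => by
      by_contra h
      exact ha (branch_anti (Order.add_one_le_of_lt (not_le.1 h)) hb)
  have hOD := isOD_pieces hH hE hxOD k
  refine ⟨fun a => piece H E x k a.1, ⟨fun a => ?_, fun a b hab y hya hyb => ?_, fun y => ?_⟩, ?_⟩
  · refine isStationaryIn_mono (hdiff a.1 a.2) fun y hy => ?_
    rw [ZFSet.mem_sdiff] at hy
    refine ZFSet.mem_sep.2 ⟨branch_subset hy.1, ?_⟩
    by_cases ha : a.1 = 0
    · refine Or.inl ⟨ha, fun b _ hb0 hb => hb0 ?_⟩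
      exact le_antisymm (ha ▸ hlt hb.1 hy.2) zero_le
    · exact Or.inr ⟨ha, hy⟩
  · obtain ⟨-, h | h⟩ := ZFSet.mem_sep.1 hya <;> obtain ⟨-, h' | h'⟩ := ZFSet.mem_sep.1 hyb
    · exact hab (Subtype.ext (h.1.trans h'.1.symm))
    · exact h.2 b.1 b.2 h'.1 h'.2
    · exact h'.2 a.1 a.2 h.1 h.2
    · exact hab (Subtype.ext (le_antisymm (hlt h.2.1 h'.2.2) (hlt h'.2.1 h.2.2)))
  · constructor
    · intro hy
      by_cases h : ∃ b, b < k ∧ b ≠ 0 ∧ y ∈ branch H E x b ∧ y ∉ branch H E x (b + 1)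
      · obtain ⟨b, hb, h⟩ := h
        exact ⟨⟨b, hb⟩, ZFSet.mem_sep.2 ⟨hy, Or.inr h⟩⟩
      · exact ⟨⟨0, hk0⟩, ZFSet.mem_sep.2 ⟨hy, Or.inl ⟨rfl, fun b hb hb0 hy' =>
          h ⟨b, hb, hb0, hy'⟩⟩⟩⟩
    · rintro ⟨a, ha⟩
      exact (ZFSet.mem_sep.1 ha).1
  · refine mem_HOD_iff.2 ⟨hOD, fun p hp => ?_⟩
    obtain ⟨a, rfl⟩ := ZFSet.mem_range.1 hp
    refine pair_mem_HOD (toZFSet_mem_HOD _) (mem_HOD_of_subset (l := l.ord) (isOD_seq_apply hOD a) ?_)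
    exact fun y hy => hEl (ZFSet.mem_sep.1 hy).1

/-- An `ω`-strongly measurable cardinal has an ordinal definable stationary subset of `cof(ω) ∩ l`
that no ordinal definable set splits. -/
theorem exists_unsplittable (hreg : l.IsRegular) (hunc : ℵ₀ < l)
    (hl : IsOmegaStronglyMeasurableInHOD l) :
    ∃ S, IsOD S ∧ S ⊆ cofOmega l.ord ∧ IsStationaryIn l.ord S ∧
      ∀ X, IsOD X → ¬ Splits l.ord S X := by
  obtain ⟨k, hk0, hk, ⟨m, hm, htwo⟩, hno⟩ := hl
  by_contra! hcon
  exact hno (exists_partition_of_split hreg hunc hcon hk0 hk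
    ((mk_subsets_le_of_isTwoPow htwo).trans_lt (lift_lt.2 (lt_ord.1 hm))))

end Atom

/-! ### The ultrafilter of an unsplittable set -/

theorem isOD_powerset {s : ZFSet.{u}} (hs : IsOD s) : IsOD s.powerset :=
  isOD_of_dfn ![s] (by simpa) 0 fun θ _ _ =>
    ⟨fun v => (v none).1 ⊆ (v (some 0)).1, inferInstance,
      fun v h => by beta_reduce; rw [h 0]; simp⟩

/-- The ordinal definable subsets of `s` that contain `S` up to a nonstationary set. For `s = S`
this is the trace of the club filter on HOD, and for `s = l` it is an ultrafilter on `l`. -/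
noncomputable def atomFilter (l : Ordinal.{u}) (S s : ZFSet.{u}) : ZFSet.{u} :=
  s.powerset.sep fun X => IsOD X ∧ ¬ IsStationaryIn l (S \ X)

theorem mem_atomFilter {l : Ordinal.{u}} {S s X : ZFSet.{u}} :
    X ∈ atomFilter l S s ↔ X ⊆ s ∧ IsOD X ∧ ¬ IsStationaryIn l (S \ X) := by
  rw [atomFilter, ZFSet.mem_sep, ZFSet.mem_powerset]

theorem isOD_atomFilter {l : Ordinal.{u}} {S s : ZFSet.{u}} (hS : IsOD S) (hs : IsOD s)
    (hSl : S ⊆ l.toZFSet) : IsOD (atomFilter l S s) := by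
  refine isOD_of_dfn ![s.powerset.sep IsOD, S, statSet l]
    (by simp [Fin.forall_fin_succ, hS, isOD_statSet, isOD_sep_isOD, isOD_powerset, hs]) 0
    fun θ _ _ =>
    ⟨fun v => (v none).1 ∈ (v (some 0)).1 ∧
      ¬ (v (some 1)).1 \ (v none).1 ∈ (v (some 2)).1, inferInstance, fun v h => ?_⟩
  beta_reduce
  have h1 : (v (some 1)).1 = S := h 1
  have h2 : (v (some 2)).1 = statSet l := h 2
  have hsub : S \ (v none).1 ⊆ l.toZFSet := fun y hy => hSl (ZFSet.mem_sdiff.1 hy).1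
  rw [h 0, h1, h2, mem_atomFilter, mem_statSet, and_iff_right hsub]
  simp only [Matrix.cons_val_zero, ZFSet.mem_sep, ZFSet.mem_powerset, and_assoc]

theorem atomFilter_mem_HOD {l : Ordinal.{u}} {S s : ZFSet.{u}} (hS : IsOD S) (hs : IsOD s)
    (hSl : S ⊆ l.toZFSet) (hsl : s ⊆ l.toZFSet) : atomFilter l S s ∈ HOD :=
  mem_HOD_iff.2 ⟨isOD_atomFilter hS hs hSl, fun _ hX =>
    mem_HOD_of_subset (mem_atomFilter.1 hX).2.1 fun _ hy => hsl ((mem_atomFilter.1 hX).1 hy)⟩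

/-- A set is in the club filter on `S` if and only if its complement in `S` is nonstationary. -/
theorem mem_clubFilterOn {l : Ordinal.{u}} {S X : ZFSet.{u}} :
    X ∈ clubFilterOn l S ↔ X ⊆ S ∧ ¬ IsStationaryIn l (S \ X) := by
  rw [clubFilterOn, ZFSet.mem_sep, ZFSet.mem_powerset, IsStationaryIn, not_isStationary_iff]
  refine and_congr_right fun _ => exists_congr fun C => and_congr_right fun _ => ?_
  rw [Set.disjoint_left]
  constructor
  · intro h a ha haC
    obtain ⟨h1, h2⟩ := ZFSet.mem_sdiff.1 (mem_ordTrace.1 ha)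
    exact h2 (h ⟨haC, h1⟩)
  · rintro h a ⟨haC, haS⟩
    by_contra haX
    exact h (show a.1.toZFSet ∈ S \ X from ZFSet.mem_sdiff.2 ⟨haS, haX⟩) haC

theorem isStationaryIn_or {l : Cardinal.{u}} (hreg : l.IsRegular) (hunc : ℵ₀ < l)
    {X A B : ZFSet.{u}} (hX : IsStationaryIn l.ord X) (h : ∀ x ∈ X, x ∈ A ∨ x ∈ B) :
    IsStationaryIn l.ord A ∨ IsStationaryIn l.ord B := by
  have hι : #(ULift.{u + 1} Bool) < lift.{u + 1} l := by
    refine (lt_aleph0_of_finite _).trans ?_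
    rw [← lift_aleph0.{u + 1, u}, lift_lt]; exact hunc
  obtain ⟨⟨i⟩, hi⟩ := exists_isStationaryIn_of_cover hreg hunc hι hX
    (fun i => if i.down then A else B) fun x hx => (h x hx).elim
      (fun h => ⟨⟨true⟩, by simpa⟩) fun h => ⟨⟨false⟩, by simpa⟩
  cases i
  · exact Or.inr (by simpa using hi)
  · exact Or.inl (by simpa using hi)

theorem not_isStationaryIn_singleton {l : Cardinal.{u}} (hreg : l.IsRegular) (a : ZFSet.{u}) :
    ¬ IsStationaryIn l.ord {a} := by
  intro h
  have hlim : Order.IsSuccLimit l.ord := isSuccLimit_ord hreg.aleph0_le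
  obtain ⟨b, hb⟩ := IsStationary.nonempty h
  have hab : b.1.toZFSet = a := ZFSet.mem_singleton.1 hb
  -- the final segment above the element is a club
  have hclub : IsClub (Set.Ioi b) := by
    refine ⟨fun d hd hne _ x hx => ?_, fun x => ?_⟩
    · obtain ⟨y, hy⟩ := hne
      exact (show b < y from hd hy).trans_le (hx.1 hy)
    · refine ⟨⟨Order.succ (max x.1 b.1), hlim.succ_lt (max_lt x.2 b.2)⟩, ?_, ?_⟩
      · exact Order.lt_succ_of_le (le_max_right x.1 b.1)
      · exact (le_max_left x.1 b.1).trans (Order.le_succ _)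
  obtain ⟨c, hc, hbc⟩ := h hclub
  have : c.1 = b.1 := Ordinal.toZFSet_injective ((ZFSet.mem_singleton.1 hc).trans hab.symm)
  exact (show b < c from hbc).ne' (Subtype.ext this)

section Ultrafilter

variable {l : Cardinal.{u}} {S s : ZFSet.{u}}

/-- The alternative for an ultrafilter is the hypothesis that `S` is unsplittable; all else holds
for every stationary `S`. -/
theorem isUltrafilterOn_atomFilter (hreg : l.IsRegular) (hunc : ℵ₀ < l) (hS : IsOD S)
    (hst : IsStationaryIn l.ord S) (hat : ∀ X, IsOD X → ¬ Splits l.ord S X) (hSs : S ⊆ s)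
    (hs : s ∈ HOD) (hsl : s ⊆ l.ord.toZFSet) (hU : atomFilter l.ord S s ∈ HOD) :
    SetModel.IsUltrafilterOn HOD.mem ⟨_, hU⟩ ⟨s, hs⟩ := by
  have hod : ∀ {X : ZFSet.{u}}, IsOD X → X ⊆ s → X ∈ HOD := fun h hX =>
    mem_HOD_of_subset h fun y hy => hsl (hX hy)
  refine ⟨fun X hX => sub_HOD.2 (mem_atomFilter.1 hX).1, ?_, fun X hX => ?_, fun X Y hX hXY hY => ?_,
    fun X Y hX hY => ?_, fun X hX => ?_⟩
  · refine mem_atomFilter.2 ⟨fun _ h => h, isOD_of_mem_HOD hs, fun h => ?_⟩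
    obtain ⟨a, ha⟩ := IsStationary.nonempty h
    have ha := ZFSet.mem_sdiff.1 (mem_ordTrace.1 ha)
    exact ha.2 (hSs ha.1)
  · by_contra hne
    refine (mem_atomFilter.1 hX).2.2 (isStationaryIn_mono hst fun y hy => ?_)
    exact ZFSet.mem_sdiff.2 ⟨hy, fun hyX => hne ⟨⟨y, mem_HOD_of_mem X.2 hyX⟩, hyX⟩⟩
  · refine mem_atomFilter.2 ⟨sub_HOD.1 hY, isOD_of_mem_HOD Y.2, fun h => ?_⟩
    refine (mem_atomFilter.1 hX).2.2 (isStationaryIn_mono h fun y hy => ?_)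
    rw [ZFSet.mem_sdiff] at hy ⊢
    exact ⟨hy.1, fun h => hy.2 (sub_HOD.1 hXY h)⟩
  · obtain ⟨hX1, hX2, hX3⟩ := mem_atomFilter.1 hX
    obtain ⟨-, hY2, hY3⟩ := mem_atomFilter.1 hY
    have hsub : X.1 ∩ Y.1 ⊆ s := fun y hy => hX1 (ZFSet.mem_inter.1 hy).1
    refine ⟨⟨X.1 ∩ Y.1, hod (isOD_inter hX2 hY2) hsub⟩,
      mem_atomFilter.2 ⟨hsub, isOD_inter hX2 hY2, fun h => ?_⟩, fun z => ZFSet.mem_inter⟩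
    refine (isStationaryIn_or hreg hunc h (A := S \ X.1) (B := S \ Y.1) fun y hy => ?_).elim hX3 hY3
    simp only [ZFSet.mem_sdiff, ZFSet.mem_inter] at hy ⊢
    tauto
  · have hXs := sub_HOD.1 hX
    have hXO := isOD_of_mem_HOD X.2
    by_cases h : IsStationaryIn l.ord (S \ X.1)
    · have hsub : s \ X.1 ⊆ s := fun y hy => (ZFSet.mem_sdiff.1 hy).1
      have hO := isOD_sdiff (isOD_of_mem_HOD hs) hXO
      refine Or.inr ⟨⟨s \ X.1, hod hO hsub⟩, mem_atomFilter.2 ⟨hsub, hO, fun h' => ?_⟩,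
        fun z => ZFSet.mem_sdiff⟩
      have hSl : S ⊆ l.ord.toZFSet := fun y hy => hsl (hSs hy)
      refine hat _ (isOD_sdiff hS hXO) ⟨fun y hy => (ZFSet.mem_sdiff.1 hy).1,
        mem_statSet.2 ⟨fun y hy => hSl (ZFSet.mem_sdiff.1 hy).1, h⟩,
        mem_statSet.2 ⟨fun y hy => hSl (ZFSet.mem_sdiff.1 hy).1,
          isStationaryIn_mono h' fun y hy => ?_⟩⟩
      simp only [ZFSet.mem_sdiff] at hy ⊢
      exact ⟨hy.1, fun h => hy.2 ⟨hSs hy.1, h.2⟩⟩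
    · exact Or.inl (mem_atomFilter.2 ⟨hXs, hXO, h⟩)

/-- A sequence in HOD is a sequence in V, and fewer than `l` nonstationary sets have a nonstationary
union. -/
theorem isCompleteOn_atomFilter (hreg : l.IsRegular) (hunc : ℵ₀ < l) (hSs : S ⊆ s)
    (hs : s ∈ HOD) (hsl : s ⊆ l.ord.toZFSet) (hU : atomFilter l.ord S s ∈ HOD) :
    SetModel.IsCompleteOn HOD.mem (HOD.ord l.ord) ⟨_, hU⟩ ⟨s, hs⟩ := by
  intro g f hg hf hfU
  obtain ⟨k, hk, rfl⟩ := exists_HOD_ord hg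
  -- the value of `f` at an ordinal below `k`
  have hval : ∀ b : Set.Iio k, ∃ X : HOD.{u}, ZFSet.pair b.1.toZFSet X.1 ∈ f.1 ∧
      ∀ X' : HOD.{u}, ZFSet.pair b.1.toZFSet X'.1 ∈ f.1 → X' = X := fun b => by
    obtain ⟨X, hX, hX'⟩ := hf.2 (HOD.ord b.1) (Ordinal.toZFSet_mem_toZFSet_iff.2 b.2)
    exact ⟨X, maps_HOD.1 hX, fun X' h => hX' X' (maps_HOD.2 h)⟩
  choose F hF hF' using hval
  have hpair : ∀ a X, ZFSet.pair a X ∈ f.1 → ∃ b : Set.Iio k, X = (F b).1 := fun a X h => by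
    obtain ⟨x, y, hx, hp⟩ := hf.1 ⟨_, mem_HOD_of_mem f.2 h⟩ h
    obtain ⟨b, hb, rfl⟩ := exists_HOD_ord hx
    obtain ⟨rfl, rfl⟩ := ZFSet.pair_injective (isOPair_HOD.1 hp)
    exact ⟨⟨b, hb⟩, congrArg Subtype.val (hF' ⟨b, hb⟩ y h)⟩
  let Y := s.sep fun z => ∀ a X, ZFSet.pair a X ∈ f.1 → z ∈ X
  have hYs : Y ⊆ s := ZFSet.sep_subset
  have hY : IsOD Y := isOD_interValues (isOD_of_mem_HOD hs) (isOD_of_mem_HOD f.2)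
  have hmemY : ∀ z, z ∈ Y ↔ z ∈ s ∧ ∀ b, z ∈ (F b).1 := fun z => by
    refine ZFSet.mem_sep.trans (and_congr_right fun _ => ⟨fun h b => h _ _ (hF b), ?_⟩)
    intro h a X hX
    obtain ⟨b, rfl⟩ := hpair a X hX
    exact h b
  refine ⟨⟨Y, mem_HOD_of_subset hY fun y hy => hsl (hYs hy)⟩,
    mem_atomFilter.2 ⟨hYs, hY, fun h => ?_⟩, fun z => ?_⟩
  · have hι : #(Set.Iio k) < lift.{u + 1} l := by
      rw [mk_Iio_ordinal]; exact lift_lt.2 (lt_ord.1 hk)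
    obtain ⟨b, hb⟩ := exists_isStationaryIn_of_cover hreg hunc hι h (fun b => S \ (F b).1)
      fun x hx => by
        rw [ZFSet.mem_sdiff, hmemY] at hx
        by_contra! hcon
        refine hx.2 ⟨hSs hx.1, fun b => ?_⟩
        by_contra hxb
        exact hcon b (ZFSet.mem_sdiff.2 ⟨hx.1, hxb⟩)
    exact (mem_atomFilter.1 (hfU (HOD.ord b.1) (F b) (maps_HOD.2 (hF b)))).2.2 hb
  · rw [HOD_mem, hmemY]
    refine and_congr_right fun _ => ⟨fun h a X hX => ?_, fun h b => ?_⟩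
    · obtain ⟨b, hb⟩ := hpair _ _ (maps_HOD.1 hX)
      rw [HOD_mem, hb]; exact h b
    · exact h (HOD.ord b.1) (F b) (maps_HOD.2 (hF b))

theorem isNonprincipal_atomFilter (hreg : l.IsRegular) (hunc : ℵ₀ < l)
    (hst : IsStationaryIn l.ord S) (hU : atomFilter l.ord S s ∈ HOD) :
    SetModel.IsNonprincipal HOD.mem ⟨_, hU⟩ := by
  rintro X hX ⟨a, ha⟩
  have hXa := isUPair_HOD.1 ha
  refine (isStationaryIn_or hreg hunc hst (A := {a.1}) (B := S \ X.1) fun y hy => ?_).elim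
    (not_isStationaryIn_singleton hreg _) (mem_atomFilter.1 hX).2.2
  rw [hXa, ZFSet.pair_eq_singleton, ZFSet.mem_sdiff]
  exact (em _).imp_right fun h => ⟨hy, h⟩

end Ultrafilter

end OrdDef

open OrdDef in
theorem mainTheorem8 (l : Cardinal.{u}) (hreg : l.IsRegular) (hunc : ℵ₀ < l)
    (hl : IsOmegaStronglyMeasurableInHOD l) :
    SetModel.IsMeasurableCardinal HOD.mem (HOD.ord l.ord) ∧
    ∃ S G : HOD.{u},
      (S : ZFSet.{u}) ⊆ cofOmega l.ord ∧
      IsStationaryIn l.ord (S : ZFSet.{u}) ∧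
      (∀ X : ZFSet.{u}, X ∈ (G : ZFSet.{u}) ↔
        X ∈ clubFilterOn l.ord (S : ZFSet.{u}) ∧ X ∈ HOD) ∧
      SetModel.IsUltrafilterOn HOD.mem G S ∧
      SetModel.IsCompleteOn HOD.mem (HOD.ord l.ord) G S ∧
      SetModel.IsNonprincipal HOD.mem G := by
  obtain ⟨S, hS, hSc, hst, hat⟩ := exists_unsplittable hreg hunc hl
  have hSl : S ⊆ l.ord.toZFSet := fun y hy => cofOmega_subset _ (hSc hy)
  have hSH : S ∈ HOD := mem_HOD_of_subset hS hSl
  have hlH := toZFSet_mem_HOD l.ord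
  have hG := atomFilter_mem_HOD hS hS hSl hSl
  have hU := atomFilter_mem_HOD hS (isOD_toZFSet l.ord) hSl fun _ h => h
  refine ⟨⟨isCard_HOD l, ⟨_, isOmega_HOD, Ordinal.toZFSet_mem_toZFSet_iff.2 ?_⟩, ⟨_, hU⟩,
      isUltrafilterOn_atomFilter hreg hunc hS hst hat hSl hlH (fun _ h => h) hU,
      isCompleteOn_atomFilter hreg hunc hSl hlH (fun _ h => h) hU,
      isNonprincipal_atomFilter hreg hunc hst hU⟩,
    ⟨S, hSH⟩, ⟨_, hG⟩, hSc, hst, fun X => ?_,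
    isUltrafilterOn_atomFilter hreg hunc hS hst hat (fun _ h => h) hSH hSl hG,
    isCompleteOn_atomFilter hreg hunc (fun _ h => h) hSH hSl hG,
    isNonprincipal_atomFilter hreg hunc hst hG⟩
  · rwa [lt_ord, Ordinal.card_omega0]
  · rw [mem_atomFilter, mem_clubFilterOn]
    exact ⟨fun ⟨h1, h2, h3⟩ => ⟨⟨h1, h3⟩, mem_HOD_of_subset h2 fun _ h => hSl (h1 h)⟩,
      fun ⟨⟨h1, h3⟩, h2⟩ => ⟨h1, isOD_of_mem_HOD h2, h3⟩⟩
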